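/- Let $\Sigma=\mathbb D^2\setminus P$ be a disk with a finite set $P$ of punctures, let $\Sigma'=\mathbb D^2\setminus P'$ with $P'\subseteq P$, let $I=[0,1]$, and let $L\subset\Sigma\times I\subset\Sigma'\times I$ be an oriented link. Let $\Bbbk$ be a field (for instance $\mathbb Q$), and let $D\subset\Sigma$ be a diagram of $L$, that is, a generic projection of a link isotopic to $L$ in $\Sigma\times I$. Let $(\mathrm{CKh}(D),d)$ be the Khovanov complex of $D$ over $\Bbbk$, with its homological grading $i$ and its quantum grading $j$; it has a basis of enhanced states $x=\{(C_a,s_a)\}_a$, i.e. complete resolutions of $D$ with a sign $s_a=\pm1$ on each circle $C_a$. Identify $H_1(\Sigma;\mathbb Z)$ with $\mathbb Z^{P}$ by the basis of counterclockwise loops around the punctures, with the product partial order. Put $g^\Sigma(x)=\sum_a s_a[C_a]\in H_1(\Sigma;\mathbb Z)$, with all circles oriented counterclockwise, and let $\mathcal F^\Sigma_v$ be the span of the enhanced states $x$ with $g^\Sigma(x)\le v$. Multipunctured Khovanov homology $\mathrm{MKh}^{i,j,v}(L\subset\Sigma\times I)$ is the homology, in homological degree $i$ and quantum degree $j$, of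 the quotient complex $\mathcal F^\Sigma_v/\sum_{b<v}\mathcal F^\Sigma_b$; and likewise for $\Sigma'$, with the same diagram $D$ viewed in $\Sigma'$. Let $\epsilon:\mathbb Z^{P}\to\mathbb Z$ be the sum of the components. Then there is a spectral sequence $(E_r^{p,i,j},d_r)_{r\ge1}$ of $\Bbbk$-vector spaces, with $d_r:E_r^{p,i,j}\to E_r^{p-r,\,i+1,\,j}$, such that $$E_1^{p,i,j}\;\cong\bigoplus_{v\in\mathbb Z^P,\ \epsilon(v)=p}\mathrm{MKh}^{i,j,v}(L\subset\Sigma\times I)\qquad\text{for all }p,i,j,$$ and which converges to $\mathrm{MKh}(L\subset\Sigma'\times I)$ with the filtration induced by $\epsilon\circ g^\Sigma$. That is, let $\Phi_p$ be the subspace of $M^{i,j}=\bigoplus_{w\in\mathbb Z^{P'}}\mathrm{MKh}^{i,j,w}(L\subset\Sigma'\times I)$ of those elements all of whose components are represented by cycles in the span of the enhanced states $x$ with $\epsilon(g^\Sigma(x))\le p$. Then $\Phi$ is a finite ascending filtration of $M^{i,j}$, and for all $p,i,j$ and all sufficiently large $r$ the differentials $d_r$ into and out of $E_r^{p,i,j}$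 vanish and $E_r^{p,i,j}\cong\Phi_p/\Phi_{p-1}$. -/

import Mathlib

open CategoryTheory

noncomputable section

/-! ### Links in a thickened punctured disk -/

/-- A disk with finitely many punctures: the closed unit disk of `ℂ` without finitely many
points of its interior. -/
structure PuncturedDisk where
  punctures : Finset ℂ
  norm_lt_one : ∀ p ∈ punctures, ‖p‖ < 1

namespace PuncturedDisk

/-- The underlying surface. -/
def carrier (X : PuncturedDisk) : Set ℂ := {z | ‖z‖ ≤ 1 ∧ z ∉ X.punctures}

end PuncturedDisk

/-- An oriented link with `k` components in `X × [0,1]`: a smooth embedding of `k` circles, each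
circle being `ℝ / ℤ` with its standard orientation. -/
@[ext] structure Link (X : PuncturedDisk) (k : ℕ) where
  strand : Fin k → ℝ → ℂ × ℝ
  smooth : ∀ i, ContDiff ℝ (⊤ : ℕ∞) (strand i)
  periodic : ∀ i, Function.Periodic (strand i) 1
  immersive : ∀ i t, deriv (strand i) t ≠ 0
  injective : ∀ i j s t, strand i s = strand j t → i = j ∧ ∃ m : ℤ, s = t + m
  mem : ∀ i t, (strand i t).1 ∈ X.carrier ∧ (strand i t).2 ∈ Set.Icc (0 : ℝ) 1

namespace Link

variable {X X' : PuncturedDisk} {k : ℕ}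

/-- Smooth isotopy through links in `X × [0,1]`. -/
def Isotopic (L M : Link X k) : Prop :=
  ∃ H : ℝ → Link X k, H 0 = L ∧ H 1 = M ∧
    ∀ i, ContDiff ℝ (⊤ : ℕ∞) (fun z : ℝ × ℝ => (H z.1).strand i z.2)

/-- A link in `X × [0,1]`, seen in `X' × [0,1]`, where `X'` has only some of the punctures
of `X`. -/
def fill (h : X'.punctures ⊆ X.punctures) (L : Link X k) : Link X' k where
  strand := L.strand
  smooth := L.smooth
  periodic := L.periodic
  immersive := L.immersive
  injective := L.injective
  mem i t := ⟨⟨(L.mem i t).1.1, fun hp => (L.mem i t).1.2 (h hp)⟩, (L.mem i t).2⟩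

theorem Isotopic.fill (h : X'.punctures ⊆ X.punctures) {L M : Link X k} (hLM : L.Isotopic M) :
    (L.fill h).Isotopic (M.fill h) := by
  obtain ⟨H, h0, h1, hs⟩ := hLM
  exact ⟨fun s => (H s).fill h, congrArg (Link.fill h) h0, congrArg (Link.fill h) h1, hs⟩

/-- The projection of a component to the plane. -/
def proj (L : Link X k) (i : Fin k) (t : ℝ) : ℂ := (L.strand i t).1

/-- The height of a point of a component. -/
def height (L : Link X k) (i : Fin k) (t : ℝ) : ℝ := (L.strand i t).2

/-- The projection of the whole link. -/
def shadow (L : Link X k) : Set ℂ := {z | ∃ i t, L.proj i t = z}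

end Link

/-! ### Link diagrams -/

/-- The combinatorial structure of an oriented link diagram in the plane, with its crossings
ordered. Every crossing `c` is passed twice, `(c, true)` being the passage along the over-strand
and `(c, false)` the one along the under-strand; `next` sends a passage to the one that follows it
along the orientation of the link. The edges of the 4-valent graph are identified with the passages
at which they start; the diagram may also have components without crossings. -/
structure LinkDiagram where
  numCrossings : ℕ
  /-- the number of components without crossings -/
  numLoops : ℕ
  /-- whether a crossing is positive -/
  positive : Fin numCrossings → Bool
  next : Equiv.Perm (Fin numCrossings × Bool)
  /-- the number of regions, i.e. of connected components of the complement in the plane -/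
  numRegions : ℕ
  /-- the unbounded region -/
  outer : Fin numRegions
  /-- the region on the left side of an edge -/
  left : (Fin numCrossings × Bool) ⊕ Fin numLoops → Fin numRegions
  /-- the region on the right side of an edge -/
  right : (Fin numCrossings × Bool) ⊕ Fin numLoops → Fin numRegions
  /-- The four corners at a crossing. The outgoing and incoming edges of the passages
  `a = (c, positive c)` and `b = (c, !positive c)` appear there in the counterclockwise
  order: out of `a`, out of `b`, into `a`, into `b`. -/
  corner₁ : ∀ c, left (.inl (c, positive c)) = right (.inl (c, !positive c))
  corner₂ : ∀ c, left (.inl (c, !positive c)) = left (.inl (next.symm (c, positive c)))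
  corner₃ : ∀ c, right (.inl (next.symm (c, positive c))) = left (.inl (next.symm (c, !positive c)))
  corner₄ : ∀ c, right (.inl (next.symm (c, !positive c))) = right (.inl (c, positive c))
  /-- Any region can be reached from the unbounded one by crossing edges. -/
  connected : ∀ A : Set (Fin numRegions), outer ∈ A → (∀ e, left e ∈ A ↔ right e ∈ A) →
    ∀ r, r ∈ A
  /-- Euler's formula `V - E + F = 1 + K` for a graph in the plane with `K` connected components
  (a component without crossings counts as a graph with one vertex and one edge). The components
  are the classes of edges for the relation generated by being incident to the same crossing. -/
  euler : numRegions = numCrossings + 1 +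
    Nat.card (Quot fun e e' : (Fin numCrossings × Bool) ⊕ Fin numLoops =>
      ∃ x y, e = .inl x ∧ e' = .inl y ∧ (x.1 = y.1 ∨ y = next x))

namespace LinkDiagram

variable (D : LinkDiagram)

/-- The passages of strands through crossings; `true` is the over-strand. -/
abbrev Passage : Type := Fin D.numCrossings × Bool

/-- The edges, together with the components without crossings. -/
abbrev Edge : Type := D.Passage ⊕ Fin D.numLoops

/-- The connected components of the complement of the diagram in the plane. -/
abbrev Region : Type := Fin D.numRegions

/-- The edge that leaves a crossing along a passage. -/
def outEdge (x : D.Passage) : D.Edge := .inl x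

/-- The edge that enters a crossing along a passage. -/
def inEdge (x : D.Passage) : D.Edge := .inl (D.next.symm x)

/-- The number of positive crossings. -/
def nPos : ℕ := (Finset.univ.filter fun c => D.positive c = true).card

/-- The number of negative crossings. -/
def nNeg : ℕ := (Finset.univ.filter fun c => D.positive c = false).card

/-- The writhe. -/
def writhe : ℤ := D.nPos - D.nNeg

/-- A choice of resolution at each crossing: `false` is the 0-resolution, `true` the
1-resolution. -/
abbrev Resolution : Type := Fin D.numCrossings → Bool

variable {D}

/-- How resolved crossings join edges. The 0-resolution of a positive crossing and the
1-resolution of a negative one follow the orientation of the strands; the other two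
resolutions do not. -/
inductive Joined (S : D.Resolution) : D.Edge → D.Edge → Prop
  | oriented (c : Fin D.numCrossings) (b : Bool) (h : S c ≠ D.positive c) :
      Joined S (D.inEdge (c, b)) (D.outEdge (c, !b))
  | unoriented_in (c : Fin D.numCrossings) (h : S c = D.positive c) :
      Joined S (D.inEdge (c, true)) (D.inEdge (c, false))
  | unoriented_out (c : Fin D.numCrossings) (h : S c = D.positive c) :
      Joined S (D.outEdge (c, true)) (D.outEdge (c, false))

/-- The circles of the resolved diagram `D(S)`. -/
def Circle (S : D.Resolution) : Type := Quot (Joined S)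

/-- The circle of `D(S)` that contains a given edge. -/
def circleOf (S : D.Resolution) (e : D.Edge) : Circle S := Quot.mk _ e

instance (S : D.Resolution) : Finite (Circle S) :=
  inferInstanceAs (Finite (Quot (Joined S)))

instance (S : D.Resolution) : Fintype (Circle S) := Fintype.ofFinite _

/-- A region (more precisely a point of it away from the crossings) lies inside the circle `C`.
Here `A` is the set of the regions inside `C`: it omits the unbounded region, and the two sides
of an edge are separated by `C` exactly if the edge belongs to `C`. -/
def Encloses {S : D.Resolution} (C : Circle S) (r : D.Region) : Prop :=
  ∃ A : Set D.Region, D.outer ∉ A ∧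
    (∀ e : D.Edge, circleOf S e = C ↔ ¬ (D.left e ∈ A ↔ D.right e ∈ A)) ∧ r ∈ A

variable (D)

/-! ### The Khovanov complex -/

/-- Enhanced states: a resolution with a sign on each of its circles; `true` stands for
`+` (or `v₊`), `false` for `-` (or `v₋`). -/
abbrev State : Type := Σ S : D.Resolution, (Circle S → Bool)

instance : Fintype D.State := Fintype.ofFinite _

/-- The numerical value of a sign. -/
def sgn (b : Bool) : ℤ := if b then 1 else -1

/-- The number `|S|` of 1-resolved crossings. -/
def weight (S : D.Resolution) : ℕ := (Finset.univ.filter fun c => S c = true).card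

variable {D}

/-- The homological degree of a generator. -/
def hDeg (x : D.State) : ℤ := D.weight x.1 - D.nNeg

/-- The quantum degree of a generator. -/
def qDeg (x : D.State) : ℤ := (∑ C, sgn (x.2 C)) + D.weight x.1 - D.nNeg + D.writhe

/-- Matrix entries of the multiplication `m : V ⊗ V → V`. -/
def mergeCoeff : Bool → Bool → Bool → ℤ
  | true, true, true => 1
  | true, false, false => 1
  | false, true, false => 1
  | _, _, _ => 0

/-- Matrix entries of the comultiplication `Δ : V → V ⊗ V`. -/
def splitCoeff : Bool → Bool → Bool → ℤ
  | true, true, false => 1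
  | true, false, true => 1
  | false, false, false => 1
  | _, _, _ => 0

open scoped Classical in
/-- The matrix entry, without sign, of the edge map of the cube of resolutions that changes the
resolution of `c`. For both resolutions of `c`, the two strands of the resolved crossing are the
one through `inEdge (c, true)` and the one through `outEdge (c, true)`. Circles that do not meet
the crossing keep their labels. -/
def edgeCoeff (c : Fin D.numCrossings) (x y : D.State) : ℤ :=
  let C₁ := circleOf x.1 (D.inEdge (c, true))
  let C₂ := circleOf x.1 (D.outEdge (c, true))
  let C₁' := circleOf y.1 (D.inEdge (c, true))
  let C₂' := circleOf y.1 (D.outEdge (c, true))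
  if ∀ e, circleOf x.1 e ≠ C₁ → circleOf x.1 e ≠ C₂ →
      y.2 (circleOf y.1 e) = x.2 (circleOf x.1 e) then
    if C₁ ≠ C₂ ∧ C₁' = C₂' then mergeCoeff (x.2 C₁) (x.2 C₂) (y.2 C₁')
    else if C₁ = C₂ ∧ C₁' ≠ C₂' then splitCoeff (x.2 C₁) (y.2 C₁') (y.2 C₂')
    else 0
  else 0

/-- The matrix entry of the Khovanov differential. -/
def dCoeff (x y : D.State) : ℤ :=
  ∑ c, if x.1 c = false ∧ y.1 = Function.update x.1 c true then
    (-1) ^ (Finset.univ.filter fun i => i < c ∧ x.1 i = true).card * edgeCoeff c x y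
  else 0

variable (D) (𝕜 : Type*) [Field 𝕜]

/-- The module underlying the Khovanov complex: the free module on the (finitely many) enhanced
states, an element being given by its coefficients. -/
abbrev CKh : Type _ := D.State → 𝕜

/-- The Khovanov differential. -/
def d : D.CKh 𝕜 →ₗ[𝕜] D.CKh 𝕜 :=
  (Matrix.of fun y x : D.State => (dCoeff x y : 𝕜)).mulVecLin

variable {D} in
/-- The submodule generated by a set of enhanced states. -/
def generatedBy (A : Set D.State) : Submodule 𝕜 (D.CKh 𝕜) where
  carrier := {f | ∀ x, f x ≠ 0 → x ∈ A}
  add_mem' {f g} hf hg x hx := by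
    by_contra h
    have h1 : f x = 0 := by_contra fun h' => h (hf x h')
    have h2 : g x = 0 := by_contra fun h' => h (hg x h')
    exact hx (by simp [h1, h2])
  zero_mem' x hx := absurd rfl hx
  smul_mem' c f hf x hx := hf x fun h => hx (by simp [h])

/-! ### Multipunctured Khovanov homology

The punctures are indexed by `ι`, and `place` gives the region of the diagram in which a puncture
lies. The first homology of the punctured disk is `ι → ℤ`, with the basis of counterclockwise loops
around the punctures, and it carries the product order. -/

variable {D} {ι : Type} [Fintype ι] (place : ι → D.Region)

open scoped Classical in
/-- The multipunctured degree `∑ sᵢ [Cᵢ]` of an enhanced state, where the circles `Cᵢ` are oriented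
counterclockwise. -/
def gDeg (x : D.State) : ι → ℤ :=
  fun p => ∑ C, if Encloses C (place p) then sgn (x.2 C) else 0

/-- The part of homological degree `i` and quantum degree `j` of the step `v` of the filtration of
the Khovanov complex by the multipunctured degree. -/
def filt (i j : ℤ) (v : ι → ℤ) : Submodule 𝕜 (D.CKh 𝕜) :=
  generatedBy 𝕜 {x | hDeg x = i ∧ qDeg x = j ∧ gDeg place x ≤ v}

/-- The sum of the smaller steps of the filtration. The associated graded complex in degree `v` is
the quotient of `filt` by this, with the induced differential. -/
def filtLT (i j : ℤ) (v : ι → ℤ) : Submodule 𝕜 (D.CKh 𝕜) :=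
  ⨆ (b : ι → ℤ) (_ : b < v), filt 𝕜 place i j b

/-- Representatives of the cycles of the associated graded complex. -/
def grCycles (i j : ℤ) (v : ι → ℤ) : Submodule 𝕜 (D.CKh 𝕜) :=
  filt 𝕜 place i j v ⊓ (filtLT 𝕜 place (i + 1) j v).comap (D.d 𝕜)

/-- Representatives of the boundaries of the associated graded complex. -/
def grBoundaries (i j : ℤ) (v : ι → ℤ) : Submodule 𝕜 (D.CKh 𝕜) :=
  filtLT 𝕜 place i j v ⊔ (filt 𝕜 place (i - 1) j v).map (D.d 𝕜)

/-- The homology of the associated graded complex: cycles modulo boundaries. -/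
def H (i j : ℤ) (v : ι → ℤ) : Type _ :=
  ↥(grCycles 𝕜 place i j v) ⧸
    (grBoundaries 𝕜 place i j v).submoduleOf (grCycles 𝕜 place i j v)

instance (i j : ℤ) (v : ι → ℤ) : AddCommGroup (H 𝕜 place i j v) :=
  inferInstanceAs (AddCommGroup (↥(grCycles 𝕜 place i j v) ⧸
    (grBoundaries 𝕜 place i j v).submoduleOf (grCycles 𝕜 place i j v)))

instance (i j : ℤ) (v : ι → ℤ) : Module 𝕜 (H 𝕜 place i j v) :=
  inferInstanceAs (Module 𝕜 (↥(grCycles 𝕜 place i j v) ⧸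
    (grBoundaries 𝕜 place i j v).submoduleOf (grCycles 𝕜 place i j v)))

/-- The homology class of a cycle. -/
def toH (i j : ℤ) (v : ι → ℤ) : ↥(grCycles 𝕜 place i j v) →ₗ[𝕜] H 𝕜 place i j v :=
  ((grBoundaries 𝕜 place i j v).submoduleOf (grCycles 𝕜 place i j v)).mkQ

/-- The homology with its multipunctured grading flattened to `ℤ`, by adding up the
components. -/
abbrev flatH (i j p : ℤ) : Type _ :=
  DirectSum {v : ι → ℤ // ∑ a, v a = p} fun v => H 𝕜 place i j v.1

/-- The homology in homological degree `i` and quantum degree `j`. -/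
abbrev totalH (i j : ℤ) : Type _ :=
  DirectSum (ι → ℤ) fun v => H 𝕜 place i j v

/-- The filtration of the Khovanov complex by the flattened multipunctured degree. -/
def flatFilt (p : ℤ) : Submodule 𝕜 (D.CKh 𝕜) :=
  generatedBy 𝕜 {x | ∑ a, gDeg place x a ≤ p}

/-- The filtration induced on the homology for a family of punctures `place'` by the flattened
multipunctured degree for another one, `place`: in each degree `w`, its step `p` consists of the
classes represented by cycles in the step `p` of the flattened filtration for `place`. -/
def inducedFilt {ι' : Type} [Fintype ι'] (place' : ι' → D.Region) (i j p : ℤ) :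
    Submodule 𝕜 (totalH 𝕜 place' i j) :=
  ⨅ w : ι' → ℤ,
    (((flatFilt 𝕜 place p).submoduleOf (grCycles 𝕜 place' i j w)).map
      (toH 𝕜 place' i j w)).comap
        (DirectSum.component 𝕜 (ι' → ℤ) (fun w => H 𝕜 place' i j w) w)

end LinkDiagram

/-! ### Diagrams of links -/

/-- A diagram of the link `L`: a link isotopic to `L` whose projection is generic (immersed, with
finitely many singular points, all of them transverse double points), and the combinatorial
structure of this projection. -/
structure Link.Diagram {X : PuncturedDisk} {k : ℕ} (L : Link X k) extends LinkDiagram where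
  /-- the link, isotopic to `L`, that is projected -/
  link : Link X k
  isotopic : L.Isotopic link
  immersed : ∀ i t, deriv (link.proj i) t ≠ 0
  /-- the component to which a passage belongs -/
  comp : toLinkDiagram.Passage → Fin k
  /-- the parameter of a passage -/
  time : toLinkDiagram.Passage → ℝ
  time_mem : ∀ x, time x ∈ Set.Ico (0 : ℝ) 1
  passage_injective : ∀ x y, comp x = comp y → time x = time y → x = y
  /-- The two passages of a crossing meet in the projection. -/
  meet : ∀ c, link.proj (comp (c, true)) (time (c, true)) =
    link.proj (comp (c, false)) (time (c, false))
  over_under : ∀ c, link.height (comp (c, false)) (time (c, false)) <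
    link.height (comp (c, true)) (time (c, true))
  /-- Every double point of the projection is a crossing. -/
  double_point : ∀ i j, ∀ s ∈ Set.Ico (0 : ℝ) 1, ∀ t ∈ Set.Ico (0 : ℝ) 1,
    link.proj i s = link.proj j t → (i = j ∧ s = t) ∨
      ∃ c b, (comp (c, b) = i ∧ time (c, b) = s) ∧ (comp (c, !b) = j ∧ time (c, !b) = t)
  /-- Crossings are transverse. At a positive crossing, the under-strand crosses the over-strand
  from the right to the left. -/
  sign_pos : ∀ c, toLinkDiagram.positive c = true →
    0 < ((starRingEnd ℂ) (deriv (link.proj (comp (c, true))) (time (c, true))) *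
      deriv (link.proj (comp (c, false))) (time (c, false))).im
  sign_neg : ∀ c, toLinkDiagram.positive c = false →
    ((starRingEnd ℂ) (deriv (link.proj (comp (c, true))) (time (c, true))) *
      deriv (link.proj (comp (c, false))) (time (c, false))).im < 0
  /-- `next x` is on the component of `x`, and is the first passage after `x`. -/
  comp_next : ∀ x, comp (toLinkDiagram.next x) = comp x
  next_spec : ∀ x, ∃ m : ℤ, time x < time (toLinkDiagram.next x) + m ∧
    ∀ y, comp y = comp x → ∀ m' : ℤ,
      ¬ (time x < time y + m' ∧ time y + m' < time (toLinkDiagram.next x) + m)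
  /-- the components without crossings -/
  loopComp : Fin toLinkDiagram.numLoops → Fin k
  loopComp_injective : Function.Injective loopComp
  loopComp_range : ∀ i, (∃ l, loopComp l = i) ↔ ∀ x, comp x ≠ i
  /-- the region of a point outside the projection -/
  regionAt : ℂ → toLinkDiagram.Region
  /-- The regions are the connected components of the complement of the projection. -/
  regionAt_eq_iff : ∀ z ∈ link.shadowᶜ, ∀ w ∈ link.shadowᶜ,
    regionAt z = regionAt w ↔ w ∈ connectedComponentIn link.shadowᶜ z
  regionAt_surjective : ∀ r, ∃ z ∈ link.shadowᶜ, regionAt z = r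
  regionAt_outer : ∀ z : ℂ, 1 < ‖z‖ → regionAt z = toLinkDiagram.outer
  /-- `left` and `right` are the regions on both sides of an edge, the edge starting at the
  passage `x` consisting of the points after `x` and before the next passage. -/
  edge_sides : ∀ x t, time x < t →
    (∀ y, comp y = comp x → ∀ m : ℤ, ¬ (time x < time y + m ∧ time y + m ≤ t)) →
    ∀ᶠ ε : ℝ in nhdsWithin 0 (Set.Ioi 0),
      regionAt (link.proj (comp x) t + ε * Complex.I * deriv (link.proj (comp x)) t) =
        toLinkDiagram.left (.inl x) ∧
      regionAt (link.proj (comp x) t - ε * Complex.I * deriv (link.proj (comp x)) t) =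
        toLinkDiagram.right (.inl x)
  loop_sides : ∀ l t, ∀ᶠ ε : ℝ in nhdsWithin 0 (Set.Ioi 0),
      regionAt (link.proj (loopComp l) t + ε * Complex.I * deriv (link.proj (loopComp l)) t) =
        toLinkDiagram.left (.inr l) ∧
      regionAt (link.proj (loopComp l) t - ε * Complex.I * deriv (link.proj (loopComp l)) t) =
        toLinkDiagram.right (.inr l)

namespace Link.Diagram

variable {X X' : PuncturedDisk} {k : ℕ} {L : Link X k}

/-- The same diagram, seen as a diagram in a disk with only some of the punctures. -/
def fill (h : X'.punctures ⊆ X.punctures) (D : L.Diagram) : (L.fill h).Diagram where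
  toLinkDiagram := D.toLinkDiagram
  link := D.link.fill h
  isotopic := D.isotopic.fill h
  immersed := D.immersed
  comp := D.comp
  time := D.time
  time_mem := D.time_mem
  passage_injective := D.passage_injective
  meet := D.meet
  over_under := D.over_under
  double_point := D.double_point
  sign_pos := D.sign_pos
  sign_neg := D.sign_neg
  comp_next := D.comp_next
  next_spec := D.next_spec
  loopComp := D.loopComp
  loopComp_injective := D.loopComp_injective
  loopComp_range := D.loopComp_range
  regionAt := D.regionAt
  regionAt_eq_iff := D.regionAt_eq_iff
  regionAt_surjective := D.regionAt_surjective
  regionAt_outer := D.regionAt_outer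
  edge_sides := D.edge_sides
  loop_sides := D.loop_sides

/-- The regions of the diagram in which the punctures lie. -/
def place (D : L.Diagram) (p : X.punctures) : D.toLinkDiagram.Region := D.regionAt p

variable (𝕜 : Type*) [Field 𝕜] (D : L.Diagram)

/-- The multipunctured Khovanov homology of the link `L` in `X × [0,1]`, computed from the
diagram `D`, with its homological grading `i`, its quantum grading `j`, and its grading `v` by the
first homology of `X`. -/
abbrev MKh (i j : ℤ) (v : X.punctures → ℤ) : Type _ := LinkDiagram.H 𝕜 D.place i j v

/-- `MKh` with the grading by the first homology of `X` flattened to a grading `p` by `ℤ`. -/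
abbrev flatMKh (i j p : ℤ) : Type _ := LinkDiagram.flatH 𝕜 D.place i j p

/-- The direct sum of all multipunctured degrees of `MKh`. -/
abbrev totalMKh (i j : ℤ) : Type _ := LinkDiagram.totalH 𝕜 D.place i j

/-- The filtration on the homology of `L` in `X' × [0,1]` induced by the flattened multipunctured
degree for `X`. -/
def filtration (h : X'.punctures ⊆ X.punctures) (i j p : ℤ) :
    Submodule 𝕜 ((D.fill h).totalMKh 𝕜 i j) :=
  LinkDiagram.inducedFilt 𝕜 D.place (D.fill h).place i j p

end Link.Diagram

/-! ### Spectral sequences of filtered complexes -/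

universe u

/-- Spectral sequences of `𝕜`-modules, from the first page on, of the type that arises from an
ascending filtration of a complex: they are graded by the filtration degree `p`, the homological
degree `i` and one more degree `j` that is preserved by all differentials. The differential of the
page `r` goes from `(p, i, j)` to `(p - r, i + 1, j)`. -/
abbrev FilteredSpectralSequence (𝕜 : Type u) [Field 𝕜] : Type _ :=
  SpectralSequence (ModuleCat.{u} 𝕜) (fun r : ℤ => ComplexShape.up' ((-r, 1, 0) : ℤ × ℤ × ℤ)) 1

/-- Convergence to a bigraded module `M` with an ascending filtration `Φ`: in each bidegree `Φ` is
finite, and at each position `(p, i, j)` the differentials of all late pages vanish and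
the entry of the page is the associated graded module of `Φ` in degree `p`. -/
def FilteredSpectralSequence.ConvergesTo {𝕜 : Type u} [Field 𝕜] (E : FilteredSpectralSequence 𝕜)
    (M : ℤ → ℤ → Type u) [∀ i j, AddCommGroup (M i j)] [∀ i j, Module 𝕜 (M i j)]
    (Φ : ∀ i j : ℤ, ℤ → Submodule 𝕜 (M i j)) : Prop :=
  (∀ i j, Monotone (Φ i j) ∧ (∃ s, Φ i j s = ⊥) ∧ ∃ t, Φ i j t = ⊤) ∧
  ∀ p i j : ℤ, ∃ R : ℤ, ∀ (r : ℤ) (hr : 1 ≤ r), R ≤ r →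
    (∀ z, (E.page r hr).d (p, i, j) z = 0) ∧ (∀ z, (E.page r hr).d z (p, i, j) = 0) ∧
    Nonempty ((E.page r hr).X (p, i, j) ≅
      ModuleCat.of 𝕜 (↥(Φ i j p) ⧸ (Φ i j (p - 1)).submoduleOf (Φ i j p)))

end

/-!
The multipunctured degree of an enhanced state is not increased by the Khovanov differential. So
the part `gradedD` of the differential that preserves the degree for `X'` is again a differential,
its homology is the sum over all degrees of the multipunctured homology for `X'`, and the complex
`(CKh, gradedD)` for `X'` is filtered by the sum of the components of the degree for `X`. The
spectral sequence is the one of this filtered complex (`FilteredComplex.spectralSequence`,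
`filteredComplex`). The filtration is finite, so it converges to the homology of `gradedD` with the
induced filtration (`FilteredComplex.convergesTo`, `filteredComplex_convergesTo`). Its first page is
the homology of the part of `gradedD` that preserves the sum of the degree for `X`. As the
differential does not increase any component of that degree, this part preserves every component;
and as `X'` has only some of the punctures of `X`, such a part of the differential also preserves
the degree for `X'`. Therefore the first page is the sum of the multipunctured homologies for `X` in
the degrees with a given sum (`nonempty_firstPage_equiv`).

That the differential squares to zero and does not increase the degree depends on the planarity of
the diagram, which is given as Euler's formula. Counting dimensions over `𝔽₂`, Euler's formula says
that every mod 2 cycle of the 4-valent graph is the boundary of a set of regions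
(`exists_coboundary_eq`). This has two consequences.

* Every circle has an interior, and the interior of a circle that is merged from two others is the
  symmetric difference of their interiors (`encloses_merge`). With the matrix entries of the
  multiplication and the comultiplication, the bound on the degree follows
  (`gDeg_le_of_dCoeff_ne_zero`).
* The regions have a checkerboard colouring. If all edges are directed so that black is on their
  left, then every resolution respects the directions, its circles are the cycles of a permutation
  of the edges, and changing one resolution multiplies that permutation by a transposition
  (`Checkerboard.succ_eq_mul_swap`). So it always merges two circles or splits a circle into two
  (`AdjacentAt.circleOf_eq_iff_ne`).

For `d² = 0` one has to see that the faces of the cube of resolutions commute. The edge maps commute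
with multiplication by `X` on the circle of any edge of the diagram (`edgeMap_mulX`), and the
complex is generated by the units of the algebras of the resolutions under these multiplications
(`linearMap_ext_of_mulX`). So it is enough to compare the two ways around a face on units
(`edgeMap_comm_oneState`), where the values of the edge maps are a unit or a sum of two of its
multiples by `X`.
-/

noncomputable section

namespace LinkDiagram

/-! ### Planarity: mod 2 cycles bound -/

section Planarity

variable (D : LinkDiagram)

/-- The mod 2 incidence matrix of the 4-valent graph. -/
def incidence : Matrix (Fin D.numCrossings) D.Edge (ZMod 2) := fun c e =>
  match e with
  | .inl x => (if x.1 = c then 1 else 0) + (if (D.next x).1 = c then 1 else 0)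
  | .inr _ => 0

theorem incidence_mulVec (f : D.Edge → ZMod 2) (c : Fin D.numCrossings) :
    D.incidence.mulVec f c = (f (D.outEdge (c, true)) + f (D.outEdge (c, false))) +
      (f (D.inEdge (c, true)) + f (D.inEdge (c, false))) := by
  have h1 : ∀ g : D.Passage → ZMod 2,
      ∑ x : D.Passage, (if x.1 = c then 1 else 0) * g x = g (c, true) + g (c, false) := by
    intro g
    rw [Fintype.sum_prod_type]
    simp
  have h2 : ∑ x : D.Passage, (if (D.next x).1 = c then 1 else 0) * f (.inl x) =
      f (.inl (D.next.symm (c, true))) + f (.inl (D.next.symm (c, false))) := by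
    rw [← h1 fun y => f (.inl (D.next.symm y))]
    exact Fintype.sum_equiv D.next _ _ fun x => by simp
  simp only [Matrix.mulVec, dotProduct, Fintype.sum_sum_type, incidence, zero_mul,
    Finset.sum_const_zero, add_zero, add_mul, Finset.sum_add_distrib]
  rw [h1 fun x => f (.inl x), h2]
  rfl

/-- The mod 2 coboundary of a function on the regions. -/
def coboundary : (D.Region → ZMod 2) →ₗ[ZMod 2] (D.Edge → ZMod 2) where
  toFun ρ e := ρ (D.left e) + ρ (D.right e)
  map_add' _ _ := by ext; simp; abel
  map_smul' _ _ := by ext; simp [mul_add]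

theorem incidence_coboundary (ρ : D.Region → ZMod 2) :
    D.incidence.mulVec (D.coboundary ρ) = 0 := by
  ext c
  rw [incidence_mulVec]
  have h1 := D.corner₁ c
  have h2 := D.corner₂ c
  have h3 := D.corner₃ c
  have h4 := D.corner₄ c
  have two : ∀ a : ZMod 2, a + a = 0 := CharTwo.add_self_eq_zero
  simp only [coboundary, LinearMap.coe_mk, AddHom.coe_mk, outEdge, inEdge, Pi.zero_apply]
  generalize D.positive c = b at *
  cases b <;> simp only [Bool.not_true, Bool.not_false] at h1 h2 h3 h4 <;>
    rw [h1, h2, h3, ← h4] <;> grind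

/-- A function with equal values on both sides of every edge is constant. -/
theorem finrank_ker_coboundary_le :
    Module.finrank (ZMod 2) (LinearMap.ker D.coboundary) ≤ 1 := by
  refine finrank_le_one ⟨fun _ => 1, funext fun _ => CharTwo.add_self_eq_zero _⟩ ?_
  rintro ⟨ρ, hρ⟩
  refine ⟨ρ D.outer, ?_⟩
  ext r
  have h := D.connected {r | ρ r = ρ D.outer} rfl (fun e => by
    have : ρ (D.left e) + ρ (D.right e) = 0 := congrFun hρ e
    rw [CharTwo.add_eq_zero] at this
    simp [this]) r
  simpa using h.symm

/-- The components of the diagram, as a graph. -/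
abbrev GraphComponent : Type := Quot fun e e' : D.Edge =>
  ∃ x y, e = .inl x ∧ e' = .inl y ∧ (x.1 = y.1 ∨ y = D.next x)

theorem finrank_ker_incidence_transpose_le :
    Module.finrank (ZMod 2) (LinearMap.ker D.incidence.transpose.mulVecLin) + D.numLoops ≤
      Nat.card D.GraphComponent := by
  classical
  let K := LinearMap.ker D.incidence.transpose.mulVecLin
  have hK : ∀ φ ∈ K, ∀ x : D.Passage, φ x.1 = φ (D.next x).1 := by
    intro φ hφ x
    have := congrFun hφ (.inl x)
    simp only [Matrix.mulVecLin_apply, Matrix.mulVec, dotProduct, Matrix.transpose_apply, incidence,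
      add_mul, Finset.sum_add_distrib, ite_mul, one_mul, zero_mul, Finset.sum_ite_eq,
      Finset.mem_univ, if_true, Pi.zero_apply] at this
    rwa [CharTwo.add_eq_zero] at this
  let val : (K × (Fin D.numLoops → ZMod 2)) → D.Edge → ZMod 2 := fun q e =>
    Sum.elim (fun x : D.Passage => q.1.1 x.1) q.2 e
  let T : (K × (Fin D.numLoops → ZMod 2)) →ₗ[ZMod 2] (D.GraphComponent → ZMod 2) :=
    { toFun := fun q => Quot.lift (val q) (by
        rintro _ _ ⟨x, y, rfl, rfl, h | rfl⟩
        · simp [val, h]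
        · exact hK _ q.1.2 x)
      map_add' := fun q q' => by
        ext ⟨e⟩
        rcases e with x | l <;> simp [val]
      map_smul' := fun a q => by
        ext ⟨e⟩
        rcases e with x | l <;> simp [val] }
  have hT : Function.Injective T := by
    rw [← LinearMap.ker_eq_bot, LinearMap.ker_eq_bot']
    rintro ⟨⟨φ, hφ⟩, l⟩ h
    ext i
    · exact congrFun h (Quot.mk _ (.inl (i, true)))
    · exact congrFun h (Quot.mk _ (.inr i))
  have := LinearMap.finrank_le_finrank_of_injective hT
  have hfin : Fintype D.GraphComponent := Fintype.ofFinite _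
  rw [Module.finrank_prod, Module.finrank_fin_fun, Module.finrank_fintype_fun_eq_card] at this
  rwa [Nat.card_eq_fintype_card]

/-- By Euler's formula, every mod 2 cycle is a coboundary: the plane has no first cohomology. -/
theorem exists_coboundary_eq (f : D.Edge → ZMod 2)
    (hf : ∀ c, (f (D.outEdge (c, true)) + f (D.outEdge (c, false))) +
      (f (D.inEdge (c, true)) + f (D.inEdge (c, false))) = 0) :
    ∃ ρ : D.Region → ZMod 2, ρ D.outer = 0 ∧ ∀ e, ρ (D.left e) + ρ (D.right e) = f e := by
  have hle : LinearMap.range D.coboundary ≤ LinearMap.ker D.incidence.mulVecLin := by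
    rintro _ ⟨ρ, rfl⟩
    exact D.incidence_coboundary ρ
  have h1 := LinearMap.finrank_range_add_finrank_ker D.coboundary
  have h2 := LinearMap.finrank_range_add_finrank_ker D.incidence.mulVecLin
  have h3 := LinearMap.finrank_range_add_finrank_ker D.incidence.transpose.mulVecLin
  have h4 : Module.finrank (ZMod 2) (LinearMap.range D.incidence.transpose.mulVecLin) =
    Module.finrank (ZMod 2) (LinearMap.range D.incidence.mulVecLin) := Matrix.rank_transpose _
  have h5 := D.finrank_ker_coboundary_le
  have h6 := D.finrank_ker_incidence_transpose_le
  have h7 : D.numRegions = D.numCrossings + 1 + Nat.card D.GraphComponent := D.euler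
  simp only [Module.finrank_fintype_fun_eq_card, Fintype.card_sum, Fintype.card_prod,
    Fintype.card_fin, Fintype.card_bool] at h1 h2 h3
  have heq := Submodule.eq_of_le_of_finrank_le hle (by omega)
  have hmem : f ∈ LinearMap.ker D.incidence.mulVecLin := by
    ext c
    simpa [incidence_mulVec] using hf c
  rw [← heq] at hmem
  obtain ⟨ρ, rfl⟩ := hmem
  refine ⟨fun r => ρ r + ρ D.outer, CharTwo.add_self_eq_zero _, fun e => ?_⟩
  have two : ∀ a : ZMod 2, a + a = 0 := CharTwo.add_self_eq_zero
  simp only [coboundary, LinearMap.coe_mk, AddHom.coe_mk]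
  grind

end Planarity

end LinkDiagram

/-! ### Cycles of permutations and transpositions -/

namespace Equiv.Perm

variable {α : Type*} [Finite α] [DecidableEq α] {π : Equiv.Perm α} {x y : α}

theorem not_sameCycle_mul_swap (hxy : x ≠ y) (h : π.SameCycle x y) :
    ¬ (π * Equiv.swap x y).SameCycle x y := by
  classical
  have hex : ∃ m : ℕ, (π ^ m) y = x := by
    obtain ⟨n, -, hn⟩ := h.symm.exists_pow_eq'
    exact ⟨n, hn⟩
  let m := Nat.find hex
  have hm : (π ^ m) y = x := Nat.find_spec hex
  have hmin : ∀ i < m, (π ^ i) y ≠ x := fun i hi => Nat.find_min hex hi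
  have hm0 : 0 < m := by
    rcases Nat.eq_zero_or_pos m with h0 | h0
    · rw [h0] at hm
      exact absurd hm.symm hxy
    · exact h0
  have hy : ∀ i, 0 < i → i ≤ m → (π ^ i) y ≠ y := by
    intro i hi him hiy
    have h1 : (π ^ (m - i)) y = x := by
      rw [← hm, ← Nat.sub_add_cancel him, pow_add, Equiv.Perm.mul_apply, hiy,
        Nat.sub_add_cancel him]
    exact hmin _ (by omega) h1
  -- The new permutation runs from `x` through `π y, π² y, …` back to `x` and misses `y`.
  have key : ∀ k : ℕ, ∃ i, 0 < i ∧ i ≤ m ∧ ((π * Equiv.swap x y) ^ k) x = (π ^ i) y := by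
    intro k
    induction k with
    | zero => exact ⟨m, hm0, le_rfl, by simp [hm]⟩
    | succ k ih =>
      obtain ⟨i, hi0, him, hi⟩ := ih
      rw [pow_succ', Equiv.Perm.mul_apply, hi, Equiv.Perm.mul_apply]
      rcases him.eq_or_lt with rfl | hlt
      · exact ⟨1, one_pos, hm0, by rw [hm, Equiv.swap_apply_left, pow_one]⟩
      · refine ⟨i + 1, by omega, hlt, ?_⟩
        rw [Equiv.swap_apply_of_ne_of_ne (hmin i hlt) (hy i hi0 him), pow_succ',
          Equiv.Perm.mul_apply]
  intro h'
  obtain ⟨k, -, hk⟩ := h'.exists_pow_eq'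
  obtain ⟨i, hi0, him, hi⟩ := key k
  exact hy i hi0 him (hi.symm.trans hk)

theorem sameCycle_mul_swap_of_not (h : ¬ π.SameCycle x y) :
    (π * Equiv.swap x y).SameCycle x y := by
  classical
  have hex : ∃ m : ℕ, 0 < m ∧ (π ^ m) y = y :=
    ⟨orderOf π, orderOf_pos π, by rw [pow_orderOf_eq_one]; rfl⟩
  let m := Nat.find hex
  have hm : 0 < m ∧ (π ^ m) y = y := Nat.find_spec hex
  have key : ∀ k, k + 1 ≤ m → ((π * Equiv.swap x y) ^ (k + 1)) x = (π ^ (k + 1)) y := by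
    intro k
    induction k with
    | zero => intro _; simp
    | succ k ih =>
      intro hk
      have hx : (π ^ (k + 1)) y ≠ x := fun e =>
        h (Equiv.Perm.SameCycle.symm ⟨(k + 1 : ℕ), by rw [zpow_natCast]; exact e⟩)
      have hy : (π ^ (k + 1)) y ≠ y := fun e => Nat.find_min hex hk ⟨by omega, e⟩
      rw [pow_succ', Equiv.Perm.mul_apply, ih (by omega), Equiv.Perm.mul_apply,
        Equiv.swap_apply_of_ne_of_ne hx hy, ← Equiv.Perm.mul_apply, ← pow_succ']
  refine ⟨(m : ℕ), ?_⟩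
  have := key (m - 1) (by omega)
  rw [Nat.sub_add_cancel hm.1] at this
  rw [zpow_natCast, this, hm.2]

/-- Multiplying a permutation by a transposition of two elements merges their cycles if they are
different, and separates them if they are in the same cycle. -/
theorem sameCycle_mul_swap_iff (hxy : x ≠ y) :
    (π * Equiv.swap x y).SameCycle x y ↔ ¬ π.SameCycle x y :=
  ⟨fun h h' => not_sameCycle_mul_swap hxy h' h, sameCycle_mul_swap_of_not⟩

end Equiv.Perm

namespace LinkDiagram

/-! ### Circles of resolutions -/

section Circles

variable {D : LinkDiagram}

theorem circleOf_eq_of_joined {S : D.Resolution} {e f : D.Edge} (h : Joined S e f) :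
    circleOf S e = circleOf S f := Quot.sound h

theorem circleOf_surjective (S : D.Resolution) : Function.Surjective (circleOf S) :=
  Quot.mk_surjective

/-- A set of edges that is closed under the joining relation is a union of circles. -/
theorem mem_iff_of_circleOf_eq {S : D.Resolution} (P : D.Edge → Prop)
    (hP : ∀ e f, Joined S e f → (P e ↔ P f)) {e f : D.Edge}
    (h : circleOf S e = circleOf S f) : P e ↔ P f := by
  have : Quot.lift P (fun e f h => propext (hP e f h)) (circleOf S e) =
    Quot.lift P (fun e f h => propext (hP e f h)) (circleOf S f) := by rw [h]
  exact iff_of_eq this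

theorem circleOf_inEdge_outEdge {S : D.Resolution} {c : Fin D.numCrossings}
    (h : S c ≠ D.positive c) (b : Bool) :
    circleOf S (D.inEdge (c, b)) = circleOf S (D.outEdge (c, !b)) :=
  circleOf_eq_of_joined (.oriented c b h)

theorem circleOf_inEdge_inEdge {S : D.Resolution} {c : Fin D.numCrossings}
    (h : S c = D.positive c) (b : Bool) :
    circleOf S (D.inEdge (c, b)) = circleOf S (D.inEdge (c, !b)) := by
  cases b
  · exact (circleOf_eq_of_joined (.unoriented_in c h)).symm
  · exact circleOf_eq_of_joined (.unoriented_in c h)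

theorem circleOf_outEdge_outEdge {S : D.Resolution} {c : Fin D.numCrossings}
    (h : S c = D.positive c) (b : Bool) :
    circleOf S (D.outEdge (c, b)) = circleOf S (D.outEdge (c, !b)) := by
  cases b
  · exact (circleOf_eq_of_joined (.unoriented_out c h)).symm
  · exact circleOf_eq_of_joined (.unoriented_out c h)

/-! ### The interior of a circle -/

/-- Every circle has an interior. -/
theorem exists_interior {S : D.Resolution} (C : Circle S) :
    ∃ A : Set D.Region, D.outer ∉ A ∧
      ∀ e : D.Edge, circleOf S e = C ↔ ¬ (D.left e ∈ A ↔ D.right e ∈ A) := by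
  classical
  obtain ⟨ρ, h0, hρ⟩ := D.exists_coboundary_eq
    (fun e => if circleOf S e = C then 1 else 0) (fun c => by
      by_cases h : S c = D.positive c
      · rw [circleOf_inEdge_inEdge h true, circleOf_outEdge_outEdge h true]
        simp [CharTwo.add_self_eq_zero]
      · rw [circleOf_inEdge_outEdge h true, circleOf_inEdge_outEdge h false]
        simp only [Bool.not_true, Bool.not_false]
        rw [add_comm (ite (circleOf S (D.outEdge (c, true)) = C) _ _)]
        exact CharTwo.add_self_eq_zero _)
  refine ⟨{r | ρ r = 1}, by simp [h0], fun e => ?_⟩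
  have := hρ e
  simp only [Set.mem_ofPred_eq]
  generalize ρ (D.left e) = a at *
  generalize ρ (D.right e) = b at *
  split_ifs at this with h
  · simp only [h, true_iff]
    revert this
    revert a b
    decide
  · simp only [h, false_iff, not_not]
    revert this
    revert a b
    decide

/-- A set of regions is determined by the edges that it separates. -/
theorem region_mem_iff {A B : Set D.Region} (h0 : D.outer ∈ A ↔ D.outer ∈ B)
    (h : ∀ e, (D.left e ∈ A ↔ D.right e ∈ A) ↔ (D.left e ∈ B ↔ D.right e ∈ B)) (r : D.Region) :
    r ∈ A ↔ r ∈ B :=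
  D.connected {r | r ∈ A ↔ r ∈ B} h0 (fun e => by
    have := h e
    simp only [Set.mem_ofPred_eq]
    tauto) r

theorem encloses_iff {S : D.Resolution} {C : Circle S} {A : Set D.Region} (h0 : D.outer ∉ A)
    (hA : ∀ e : D.Edge, circleOf S e = C ↔ ¬ (D.left e ∈ A ↔ D.right e ∈ A)) (r : D.Region) :
    Encloses C r ↔ r ∈ A := by
  refine ⟨?_, fun h => ⟨A, h0, hA, h⟩⟩
  rintro ⟨B, hB0, hB, hr⟩
  refine (region_mem_iff (by tauto) (fun e => ?_) r).1 hr
  have h1 := hA e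
  have h2 := hB e
  tauto

/-- Circles with the same edges have the same interior. -/
theorem encloses_congr {S S' : D.Resolution} {C : Circle S} {C' : Circle S'}
    (h : ∀ e, circleOf S e = C ↔ circleOf S' e = C') (r : D.Region) :
    Encloses C r ↔ Encloses C' r := by
  obtain ⟨A, h0, hA⟩ := exists_interior C
  rw [encloses_iff h0 hA, encloses_iff h0 fun e => (h e).symm.trans (hA e)]

/-- If two circles merge, the interior of the result is the symmetric difference of the
interiors. -/
theorem encloses_merge {S S' : D.Resolution} {C₁ C₂ : Circle S} {C' : Circle S'} (hne : C₁ ≠ C₂)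
    (h : ∀ e, circleOf S' e = C' ↔ circleOf S e = C₁ ∨ circleOf S e = C₂) (r : D.Region) :
    Encloses C' r ↔ ¬ (Encloses C₁ r ↔ Encloses C₂ r) := by
  obtain ⟨A₁, h1, hA₁⟩ := exists_interior C₁
  obtain ⟨A₂, h2, hA₂⟩ := exists_interior C₂
  rw [encloses_iff h1 hA₁, encloses_iff h2 hA₂,
    encloses_iff (A := {r | ¬ (r ∈ A₁ ↔ r ∈ A₂)}) (by simp [h1, h2]) fun e => ?_]
  · rfl
  · have e1 := hA₁ e
    have e2 := hA₂ e
    have e3 := h e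
    have e4 : ¬ (circleOf S e = C₁ ∧ circleOf S e = C₂) := fun ⟨a, b⟩ => hne (a.symm.trans b)
    simp only [Set.mem_ofPred_eq]
    tauto

end Circles

end LinkDiagram

namespace LinkDiagram

/-! ### Changing the resolution of a crossing -/

section Adjacent

variable {D : LinkDiagram}

/-- A checkerboard colouring of the regions, recorded by the edges that have a black region on
their left. At each crossing these are one of the two outgoing edges and the incoming edge of the
other strand. -/
structure Checkerboard (D : LinkDiagram) where
  /-- whether the region on the left of the edge that leaves along a passage is black -/
  black : D.Passage → Bool
  black_not : ∀ c b, black (c, !b) = !black (c, b)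
  black_next : ∀ x, black (D.next.symm x) = !black x

/-- The all-one cycle bounds, which gives a checkerboard colouring. -/
theorem exists_checkerboard (D : LinkDiagram) : Nonempty D.Checkerboard := by
  obtain ⟨κ, -, hκ⟩ := D.exists_coboundary_eq (fun _ => 1) (fun c => by decide)
  have hne : ∀ e, decide (κ (D.left e) = 1) = !decide (κ (D.right e) = 1) := by
    intro e
    have := hκ e
    generalize κ (D.left e) = a at *
    generalize κ (D.right e) = b at *
    revert a b
    decide
  let σ : D.Passage → Bool := fun x => decide (κ (D.left (.inl x)) = 1)
  have h1 : ∀ c, σ (c, !D.positive c) = !σ (c, D.positive c) := by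
    intro c
    simp only [σ, D.corner₁ c, hne (.inl (c, !D.positive c))]
  have h2 : ∀ c, σ (D.next.symm (c, D.positive c)) = !σ (c, D.positive c) := by
    intro c
    rw [← h1]
    simp only [σ, D.corner₂ c]
  have h3 : ∀ c, σ (D.next.symm (c, !D.positive c)) = !σ (c, !D.positive c) := by
    intro c
    rw [h1, ← h2]
    simp only [σ, ← D.corner₃ c]
    rw [hne (.inl (D.next.symm (c, D.positive c))), Bool.not_not]
  refine ⟨σ, fun c b => ?_, fun x => ?_⟩
  · have := h1 c
    generalize D.positive c = p at this
    cases b <;> cases p <;> simp_all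
  · obtain ⟨c, b⟩ := x
    by_cases hb : b = D.positive c
    · rw [hb, h2]
    · rw [Bool.eq_not.mpr hb, h3]

/-- Two resolutions that differ exactly at the crossing `c`. -/
structure AdjacentAt (c : Fin D.numCrossings) (S S' : D.Resolution) : Prop where
  eq_of_ne : ∀ i, i ≠ c → S i = S' i
  ne : S c ≠ S' c

theorem AdjacentAt.symm {c : Fin D.numCrossings} {S S' : D.Resolution} (h : AdjacentAt c S S') :
    AdjacentAt c S' S :=
  ⟨fun i hi => (h.eq_of_ne i hi).symm, h.ne.symm⟩

theorem adjacentAt_update {c : Fin D.numCrossings} {S : D.Resolution} (h : S c = false) :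
    AdjacentAt c S (Function.update S c true) :=
  ⟨fun i hi => by simp [hi], by simp [h]⟩

namespace Checkerboard

variable (κ : D.Checkerboard)

/-- The edge that leaves (for `true`) or enters (for `false`) a crossing `c` along the passage
`(c, b c)`. -/
def halfEdge (b : Fin D.numCrossings → Bool) (q : Fin D.numCrossings × Bool) : D.Passage :=
  if q.2 then (q.1, b q.1) else D.next.symm (q.1, b q.1)

theorem halfEdge_bijective (b : Fin D.numCrossings → Bool) (v : Bool)
    (hb : ∀ c, κ.black (c, b c) = v) : Function.Bijective (halfEdge (D := D) b) := by
  refine Finite.injective_iff_bijective.1 ?_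
  rintro ⟨c, io⟩ ⟨c', io'⟩ h
  have hs := congrArg κ.black h
  have hn := κ.black_next
  cases io <;> cases io' <;> simp only [halfEdge, if_true, Bool.false_eq_true, if_false] at h hs
  · have := D.next.symm.injective h
    simp_all
  · rw [hn, hb, hb] at hs
    cases v <;> simp at hs
  · rw [hn, hb, hb] at hs
    cases v <;> simp at hs
  · simp_all

/-- Let all edges be directed so that the black regions are on their left. The passage at a
crossing `c` whose two edges depart from `c` is `(c, strand c)`. -/
def strand (c : Fin D.numCrossings) : Bool := κ.black (c, true)

theorem black_strand (c : Fin D.numCrossings) : κ.black (c, κ.strand c) = true := by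
  have := κ.black_not c true
  unfold strand
  cases h : κ.black (c, true)
  · rw [h] at this
    exact this
  · exact h

/-- The edges departing from the crossings. -/
def depart : Fin D.numCrossings × Bool ≃ D.Passage :=
  Equiv.ofBijective _ (κ.halfEdge_bijective κ.strand true κ.black_strand)

/-- The edges arriving at the crossings. -/
def arrive : Fin D.numCrossings × Bool ≃ D.Passage :=
  Equiv.ofBijective _ (κ.halfEdge_bijective (fun c => !κ.strand c) false fun c => by
    rw [κ.black_not, κ.black_strand]; rfl)

theorem depart_true (c : Fin D.numCrossings) : κ.depart (c, true) = (c, κ.strand c) := rfl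

theorem depart_false (c : Fin D.numCrossings) :
    κ.depart (c, false) = D.next.symm (c, κ.strand c) := rfl

theorem arrive_true (c : Fin D.numCrossings) : κ.arrive (c, true) = (c, !κ.strand c) := rfl

theorem arrive_false (c : Fin D.numCrossings) :
    κ.arrive (c, false) = D.next.symm (c, !κ.strand c) := rfl

/-- How the resolution `S` connects the arriving to the departing half-edges. -/
def connect (S : D.Resolution) : Equiv.Perm (Fin D.numCrossings × Bool) :=
  Function.Involutive.toPerm (fun q => (q.1, xor q.2 (xor (S q.1) (D.positive q.1)))) fun q => by
    ext <;> simp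

theorem connect_apply (S : D.Resolution) (q : Fin D.numCrossings × Bool) :
    connect S q = (q.1, xor q.2 (xor (S q.1) (D.positive q.1))) := rfl

/-- The first return map of the resolved diagram: it sends an edge, directed so that black is on
its left, to the one that follows it on its circle. -/
def succ (S : D.Resolution) : Equiv.Perm D.Passage :=
  (κ.arrive.symm.trans (connect S)).trans κ.depart

theorem succ_arrive (S : D.Resolution) (q : Fin D.numCrossings × Bool) :
    κ.succ S (κ.arrive q) = κ.depart (connect S q) := by
  simp [succ]

theorem circleOf_succ (S : D.Resolution) (x : D.Passage) :
    circleOf S (.inl (κ.succ S x)) = circleOf S (.inl x) := by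
  obtain ⟨⟨c, io⟩, rfl⟩ := κ.arrive.surjective x
  rw [succ_arrive, connect_apply]
  by_cases h : S c = D.positive c
  · have h' : xor (S c) (D.positive c) = false := by simp [h]
    simp only [h', Bool.xor_false]
    cases io
    · rw [depart_false, arrive_false]
      exact circleOf_inEdge_inEdge h _
    · rw [depart_true, arrive_true]
      exact circleOf_outEdge_outEdge h _
  · have h' : xor (S c) (D.positive c) = true := by simpa using h
    simp only [h', Bool.xor_true]
    cases io
    · rw [Bool.not_false, depart_true, arrive_false]
      have := circleOf_inEdge_outEdge h (!κ.strand c)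
      rw [Bool.not_not] at this
      exact this.symm
    · rw [Bool.not_true, depart_false, arrive_true]
      exact circleOf_inEdge_outEdge h _

theorem sameCycle_of_connect {S : D.Resolution} {c : Fin D.numCrossings} {io io' : Bool}
    (h : io' = xor io (xor (S c) (D.positive c))) :
    (κ.succ S).SameCycle (κ.arrive (c, io)) (κ.depart (c, io')) :=
  ⟨1, by rw [zpow_one, succ_arrive, connect_apply, h]⟩

/-- The circles are the cycles of the return map. -/
theorem circleOf_eq_iff (S : D.Resolution) (x y : D.Passage) :
    circleOf S (.inl x) = circleOf S (.inl y) ↔ (κ.succ S).SameCycle x y := by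
  constructor
  · intro h
    let P : D.Edge → Prop := Sum.elim (fun z => (κ.succ S).SameCycle x z) fun _ => False
    have hP : ∀ e f, Joined S e f → (P e ↔ P f) := by
      have key : ∀ z w : D.Passage, (κ.succ S).SameCycle z w → (P (.inl z) ↔ P (.inl w)) :=
        fun z w hzw => ⟨fun hz => hz.trans hzw, fun hw => hw.trans hzw.symm⟩
      intro e f hef
      rcases hef with ⟨c, b, hc⟩ | ⟨c, hc⟩ | ⟨c, hc⟩
      · have hx : xor (S c) (D.positive c) = true := by simpa using hc
        refine key _ _ ?_
        by_cases hb : b = κ.strand c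
        · subst hb
          exact (κ.sameCycle_of_connect (io := true) (io' := false) (by simp [hx])).symm
        · rw [Bool.eq_not.mpr hb]
          have := κ.sameCycle_of_connect (S := S) (c := c) (io := false) (io' := true)
            (by simp [hx])
          rw [Bool.not_not]
          exact this
      · have hx : xor (S c) (D.positive c) = false := by simpa using hc
        have h0 := κ.sameCycle_of_connect (S := S) (c := c) (io := false) (io' := false)
          (by simp [hx])
        rw [arrive_false, depart_false] at h0
        refine key _ _ ?_
        generalize κ.strand c = s at h0
        cases s
        · exact h0
        · exact h0.symm
      · have hx : xor (S c) (D.positive c) = false := by simpa using hc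
        have h0 := κ.sameCycle_of_connect (S := S) (c := c) (io := true) (io' := true)
          (by simp [hx])
        rw [arrive_true, depart_true] at h0
        refine key _ _ ?_
        generalize κ.strand c = s at h0
        cases s
        · exact h0
        · exact h0.symm
    exact (mem_iff_of_circleOf_eq P hP h).1 (Equiv.Perm.SameCycle.refl _ _)
  · rintro ⟨n, rfl⟩
    have hstep : ∀ z, circleOf S (.inl ((κ.succ S)⁻¹ z)) = circleOf S (.inl z) := fun z => by
      rw [← κ.circleOf_succ S ((κ.succ S)⁻¹ z), ← Equiv.Perm.mul_apply, mul_inv_cancel,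
        Equiv.Perm.one_apply]
    induction n with
    | zero => rfl
    | succ n ih => rw [add_comm, zpow_add, zpow_one, Equiv.Perm.mul_apply, circleOf_succ, ih]
    | pred n ih => rw [sub_eq_neg_add, zpow_add, zpow_neg_one, Equiv.Perm.mul_apply, hstep, ih]

/-- Changing the resolution of a crossing multiplies the return map by a transposition. -/
theorem succ_eq_mul_swap {c : Fin D.numCrossings} {S S' : D.Resolution} (h : AdjacentAt c S S') :
    κ.succ S' = κ.succ S * Equiv.swap (κ.arrive (c, true)) (κ.arrive (c, false)) := by
  ext1 x
  obtain ⟨⟨i, io⟩, rfl⟩ := κ.arrive.surjective x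
  rw [Equiv.Perm.mul_apply, ← κ.arrive.injective.map_swap, succ_arrive, succ_arrive]
  by_cases hi : i = c
  · subst hi
    have hne : S' i = !S i := Bool.eq_not.mpr h.ne.symm
    cases io <;> simp [connect_apply, hne]
  · rw [Equiv.swap_apply_of_ne_of_ne (by simp [hi]) (by simp [hi]), connect_apply, connect_apply,
      h.eq_of_ne i hi]

theorem sameCycle_strands (S : D.Resolution) (c : Fin D.numCrossings) :
    circleOf S (D.inEdge (c, true)) = circleOf S (D.outEdge (c, true)) ↔
      (κ.succ S).SameCycle (κ.arrive (c, true)) (κ.arrive (c, false)) := by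
  have h : circleOf S (D.inEdge (c, true)) = circleOf S (D.outEdge (c, true)) ↔
      (κ.succ S).SameCycle (D.next.symm (c, true)) (c, true) := κ.circleOf_eq_iff S _ _
  rw [h]
  by_cases hs : κ.strand c = true
  · have h1 := κ.depart_true c
    have h2 := κ.depart_false c
    rw [hs] at h1 h2
    rw [← h2]
    nth_rewrite 1 [← h1]
    have e1 := κ.sameCycle_of_connect (S := S) (c := c) (io := true) rfl
    have e2 := κ.sameCycle_of_connect (S := S) (c := c) (io := false) rfl
    generalize xor (S c) (D.positive c) = b at e1 e2
    cases b
    · exact ⟨fun h => (e1.trans h.symm).trans e2.symm, fun h => (e2.symm.trans h.symm).trans e1⟩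
    · exact ⟨fun h => (e1.trans h).trans e2.symm, fun h => (e1.symm.trans h).trans e2⟩
  · have h1 := κ.arrive_true c
    have h2 := κ.arrive_false c
    rw [Bool.not_eq_true] at hs
    rw [hs, Bool.not_false] at h1 h2
    rw [h1, h2]
    exact Equiv.Perm.sameCycle_comm

end Checkerboard

/-- A change of one resolution merges two circles or splits a circle into two: the number of
circles cannot stay the same, because the diagram is planar. -/
theorem AdjacentAt.circleOf_eq_iff_ne {c : Fin D.numCrossings} {S S' : D.Resolution}
    (h : AdjacentAt c S S') :
    circleOf S' (D.inEdge (c, true)) = circleOf S' (D.outEdge (c, true)) ↔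
      circleOf S (D.inEdge (c, true)) ≠ circleOf S (D.outEdge (c, true)) := by
  obtain ⟨κ⟩ := D.exists_checkerboard
  rw [Ne, κ.sameCycle_strands, κ.sameCycle_strands, κ.succ_eq_mul_swap h]
  exact Equiv.Perm.sameCycle_mul_swap_iff (κ.arrive.injective.ne (by simp))

/-- The circle of `e` does not pass the crossing `c`. -/
def Avoids (S : D.Resolution) (c : Fin D.numCrossings) (e : D.Edge) : Prop :=
  circleOf S e ≠ circleOf S (D.inEdge (c, true)) ∧ circleOf S e ≠ circleOf S (D.outEdge (c, true))

theorem Avoids.congr {S : D.Resolution} {c : Fin D.numCrossings} {e f : D.Edge}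
    (h : Avoids S c e) (hef : circleOf S e = circleOf S f) : Avoids S c f := by
  rwa [Avoids, ← hef]

theorem Avoids.ne_inEdge {S : D.Resolution} {c : Fin D.numCrossings} {e : D.Edge}
    (h : Avoids S c e) (b : Bool) : circleOf S e ≠ circleOf S (D.inEdge (c, b)) := by
  cases b
  · by_cases hc : S c = D.positive c
    · rw [circleOf_inEdge_inEdge hc]; exact h.1
    · rw [circleOf_inEdge_outEdge hc]; exact h.2
  · exact h.1

theorem Avoids.ne_outEdge {S : D.Resolution} {c : Fin D.numCrossings} {e : D.Edge}
    (h : Avoids S c e) (b : Bool) : circleOf S e ≠ circleOf S (D.outEdge (c, b)) := by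
  cases b
  · by_cases hc : S c = D.positive c
    · rw [circleOf_outEdge_outEdge hc]; exact h.2
    · have := circleOf_inEdge_outEdge hc true
      rw [Bool.not_true] at this
      rw [← this]; exact h.1
  · exact h.2

/-- The edge starts or ends at the crossing `c`. -/
def Incident (c : Fin D.numCrossings) (e : D.Edge) : Prop :=
  ∃ b, e = D.inEdge (c, b) ∨ e = D.outEdge (c, b)

theorem Avoids.ne_of_incident {S : D.Resolution} {c : Fin D.numCrossings} {e f : D.Edge}
    (h : Avoids S c e) (hf : Incident c f) : circleOf S e ≠ circleOf S f := by
  obtain ⟨b, rfl | rfl⟩ := hf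
  · exact h.ne_inEdge b
  · exact h.ne_outEdge b

theorem AdjacentAt.joined {c : Fin D.numCrossings} {S S' : D.Resolution}
    (h : AdjacentAt c S S') {e f : D.Edge} (hef : Joined S e f) :
    Joined S' e f ∨ (Incident c e ∧ Incident c f) := by
  rcases hef with ⟨i, b, hi⟩ | ⟨i, hi⟩ | ⟨i, hi⟩ <;> by_cases hic : i = c
  · subst hic
    exact .inr ⟨⟨_, .inl rfl⟩, ⟨_, .inr rfl⟩⟩
  · exact .inl (.oriented i b (h.eq_of_ne i hic ▸ hi))
  · subst hic
    exact .inr ⟨⟨_, .inl rfl⟩, ⟨_, .inl rfl⟩⟩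
  · exact .inl (.unoriented_in i (h.eq_of_ne i hic ▸ hi))
  · subst hic
    exact .inr ⟨⟨_, .inr rfl⟩, ⟨_, .inr rfl⟩⟩
  · exact .inl (.unoriented_out i (h.eq_of_ne i hic ▸ hi))

/-- Circles that avoid a crossing do not change with its resolution. -/
theorem AdjacentAt.circleOf_eq_of_avoids {c : Fin D.numCrossings} {S S' : D.Resolution}
    (h : AdjacentAt c S S') {e f : D.Edge} (he : Avoids S c e) :
    circleOf S' e = circleOf S' f ↔ circleOf S e = circleOf S f := by
  constructor
  · intro hef
    refine (mem_iff_of_circleOf_eq (fun f => circleOf S e = circleOf S f) ?_ hef).1 rfl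
    intro f g hfg
    rcases h.symm.joined hfg with hj | ⟨hf, hg⟩
    · rw [circleOf_eq_of_joined hj]
    · exact iff_of_false (he.ne_of_incident hf) (he.ne_of_incident hg)
  · intro hef
    refine ((mem_iff_of_circleOf_eq
      (fun f => circleOf S e = circleOf S f ∧ circleOf S' e = circleOf S' f) ?_ hef).1
        ⟨rfl, rfl⟩).2
    intro f g hfg
    rcases h.joined hfg with hj | ⟨hf, hg⟩
    · rw [circleOf_eq_of_joined hfg, circleOf_eq_of_joined hj]
    · exact iff_of_false (fun h' => he.ne_of_incident hf h'.1) fun h' => he.ne_of_incident hg h'.1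

theorem AdjacentAt.avoids_iff {c : Fin D.numCrossings} {S S' : D.Resolution}
    (h : AdjacentAt c S S') (e : D.Edge) : Avoids S c e ↔ Avoids S' c e := by
  constructor
  · intro he
    refine ⟨fun h' => ?_, fun h' => ?_⟩
    · exact he.1 ((h.circleOf_eq_of_avoids he).1 h')
    · exact he.2 ((h.circleOf_eq_of_avoids he).1 h')
  · intro he
    refine ⟨fun h' => ?_, fun h' => ?_⟩
    · exact he.1 ((h.symm.circleOf_eq_of_avoids he).1 h')
    · exact he.2 ((h.symm.circleOf_eq_of_avoids he).1 h')

/-- If the strands at `c` are on one circle in `S'`, its edges are those of the circles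
through `c` in `S`. -/
theorem AdjacentAt.circleOf_eq_strand_iff {c : Fin D.numCrossings} {S S' : D.Resolution}
    (h : AdjacentAt c S S')
    (hc : circleOf S' (D.inEdge (c, true)) = circleOf S' (D.outEdge (c, true))) (e : D.Edge) :
    circleOf S' e = circleOf S' (D.inEdge (c, true)) ↔
      circleOf S e = circleOf S (D.inEdge (c, true)) ∨
        circleOf S e = circleOf S (D.outEdge (c, true)) := by
  have := h.avoids_iff e
  unfold Avoids at this
  rw [← hc] at this
  tauto

/-- A sum over circles, split into the circles through a crossing and the other ones, changes in
the first part only when the resolution of the crossing does. -/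
theorem AdjacentAt.sum_circles {M : Type*} [AddCommGroup M] {c : Fin D.numCrossings}
    {S S' : D.Resolution} (h : AdjacentAt c S S')
    (hne : circleOf S (D.inEdge (c, true)) ≠ circleOf S (D.outEdge (c, true)))
    (φ : Circle S → M) (φ' : Circle S' → M)
    (hφ : ∀ e, Avoids S c e → φ (circleOf S e) = φ' (circleOf S' e)) :
    ∑ C, φ C - φ (circleOf S (D.inEdge (c, true))) - φ (circleOf S (D.outEdge (c, true))) =
      ∑ C, φ' C - φ' (circleOf S' (D.inEdge (c, true))) := by
  classical
  set a := D.inEdge (c, true)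
  set b := D.outEdge (c, true)
  have hc : circleOf S' a = circleOf S' b := h.circleOf_eq_iff_ne.2 hne
  have h1 : ∑ C, φ C = φ (circleOf S a) + (φ (circleOf S b) +
      ∑ C ∈ (Finset.univ.erase (circleOf S a)).erase (circleOf S b), φ C) := by
    rw [Finset.add_sum_erase _ _ (by simp [hne.symm]), Finset.add_sum_erase _ _ (by simp)]
  have h2 : ∑ C, φ' C = φ' (circleOf S' a) +
      ∑ C ∈ Finset.univ.erase (circleOf S' a), φ' C := by
    rw [Finset.add_sum_erase _ _ (by simp)]
  have h3 : ∑ C ∈ (Finset.univ.erase (circleOf S a)).erase (circleOf S b), φ C =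
      ∑ C ∈ Finset.univ.erase (circleOf S' a), φ' C := by
    have hmem : ∀ e, circleOf S e ∈ (Finset.univ.erase (circleOf S a)).erase (circleOf S b) →
        Avoids S c e := fun e he => by
      simp only [Finset.mem_erase, Finset.mem_univ, and_true] at he
      exact ⟨he.2, he.1⟩
    have hrep : ∀ C : Circle S, circleOf S C.out = C := fun C => Quot.out_eq C
    refine Finset.sum_bij (fun C _ => circleOf S' C.out) ?_ ?_ ?_ ?_
    · intro C hC
      rw [← hrep C] at hC
      simpa using ((h.avoids_iff _).1 (hmem _ hC)).1
    · intro C hC C' _ hCC'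
      rw [← hrep C] at hC
      rw [← hrep C, ← hrep C']
      exact (h.circleOf_eq_of_avoids (hmem _ hC)).1 hCC'
    · intro C' hC'
      obtain ⟨e, rfl⟩ := circleOf_surjective S' C'
      have he : Avoids S' c e := by
        simp only [Finset.mem_erase, Finset.mem_univ, and_true] at hC'
        exact ⟨hC', hc ▸ hC'⟩
      have he' := (h.avoids_iff e).2 he
      refine ⟨circleOf S e, by simpa using ⟨he'.2, he'.1⟩, ?_⟩
      exact ((h.circleOf_eq_of_avoids he').2 (hrep _).symm).symm
    · intro C hC
      rw [← hrep C] at hC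
      have := hφ _ (hmem _ hC)
      rwa [hrep] at this
  rw [h1, h2, h3]
  abel

end Adjacent
end LinkDiagram

namespace LinkDiagram

/-! ### The edge maps of the cube of resolutions -/

section Cube

variable {D : LinkDiagram}

/-- The sign on the circle of an edge. -/
def label (x : D.State) (e : D.Edge) : Bool := x.2 (circleOf x.1 e)

theorem label_congr (x : D.State) {e f : D.Edge} (h : circleOf x.1 e = circleOf x.1 f) :
    label x e = label x f := by rw [label, h, label]

open scoped Classical in
/-- Change the sign on the circle of an edge. -/
def flip (e : D.Edge) (x : D.State) : D.State :=
  ⟨x.1, fun C => if C = circleOf x.1 e then !x.2 C else x.2 C⟩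

theorem flip_fst (e : D.Edge) (x : D.State) : (flip e x).1 = x.1 := rfl

theorem label_flip_of_eq {x : D.State} {e f : D.Edge} (h : circleOf x.1 f = circleOf x.1 e) :
    label (flip e x) f = !label x f := if_pos h

theorem label_flip_of_ne {x : D.State} {e f : D.Edge} (h : circleOf x.1 f ≠ circleOf x.1 e) :
    label (flip e x) f = label x f := if_neg h

theorem state_ext {x y : D.State} (h : x.1 = y.1) (hl : ∀ e, label x e = label y e) : x = y := by
  obtain ⟨S, s⟩ := x
  obtain ⟨S', t⟩ := y
  obtain rfl : S = S' := h
  congr 1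
  funext C
  obtain ⟨e, rfl⟩ := circleOf_surjective S C
  exact hl e

theorem flip_flip (e : D.Edge) (x : D.State) : flip e (flip e x) = x := by
  refine state_ext rfl fun f => ?_
  by_cases h : circleOf x.1 f = circleOf x.1 e
  · rw [label_flip_of_eq (x := flip e x) h, label_flip_of_eq h, Bool.not_not]
  · rw [label_flip_of_ne (x := flip e x) h, label_flip_of_ne h]

theorem flip_comm (e f : D.Edge) (x : D.State) : flip e (flip f x) = flip f (flip e x) := by
  refine state_ext rfl fun g => ?_
  by_cases h : circleOf x.1 g = circleOf x.1 e <;> by_cases h' : circleOf x.1 g = circleOf x.1 f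
  · rw [label_flip_of_eq (x := flip f x) h, label_flip_of_eq h',
      label_flip_of_eq (x := flip e x) h', label_flip_of_eq h]
  · rw [label_flip_of_eq (x := flip f x) h, label_flip_of_ne h',
      label_flip_of_ne (x := flip e x) h', label_flip_of_eq h]
  · rw [label_flip_of_ne (x := flip f x) h, label_flip_of_eq h',
      label_flip_of_eq (x := flip e x) h', label_flip_of_ne h]
  · rw [label_flip_of_ne (x := flip f x) h, label_flip_of_ne h',
      label_flip_of_ne (x := flip e x) h', label_flip_of_ne h]

/-- The states `x` and `y` have the same signs on the circles that avoid the crossing `c`. -/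
def AgreeOff (c : Fin D.numCrossings) (x y : D.State) : Prop :=
  ∀ e, Avoids x.1 c e → label y e = label x e

section
open scoped Classical

theorem edgeCoeff_merge {c : Fin D.numCrossings} {x y : D.State}
    (h : circleOf x.1 (D.inEdge (c, true)) ≠ circleOf x.1 (D.outEdge (c, true)))
    (h' : circleOf y.1 (D.inEdge (c, true)) = circleOf y.1 (D.outEdge (c, true))) :
    edgeCoeff c x y = if AgreeOff c x y then
      mergeCoeff (label x (D.inEdge (c, true))) (label x (D.outEdge (c, true)))
        (label y (D.inEdge (c, true))) else 0 := by
  simp only [edgeCoeff, AgreeOff, Avoids, label, and_imp]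
  rw [if_pos (⟨h, h'⟩ : _ ∧ _)]

theorem edgeCoeff_split {c : Fin D.numCrossings} {x y : D.State}
    (h : circleOf x.1 (D.inEdge (c, true)) = circleOf x.1 (D.outEdge (c, true)))
    (h' : circleOf y.1 (D.inEdge (c, true)) ≠ circleOf y.1 (D.outEdge (c, true))) :
    edgeCoeff c x y = if AgreeOff c x y then
      splitCoeff (label x (D.inEdge (c, true))) (label y (D.inEdge (c, true)))
        (label y (D.outEdge (c, true))) else 0 := by
  simp only [edgeCoeff, AgreeOff, Avoids, label, and_imp]
  rw [if_neg (not_and_of_not_left _ (not_not.2 h)), if_pos (⟨h, h'⟩ : _ ∧ _)]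

theorem agreeOff_flip_left_of_not_avoids {c : Fin D.numCrossings} {x y : D.State} {e : D.Edge}
    (he : ¬ Avoids x.1 c e) : AgreeOff c (flip e x) y ↔ AgreeOff c x y := by
  refine forall_congr' fun f => imp_congr_right fun hf => ?_
  have hf' : Avoids x.1 c f := hf
  rw [label_flip_of_ne fun h => he (hf'.congr h)]

theorem agreeOff_flip_right_of_not_avoids {c : Fin D.numCrossings} {x y : D.State} {e : D.Edge}
    (h : AdjacentAt c x.1 y.1) (he : ¬ Avoids x.1 c e) :
    AgreeOff c x (flip e y) ↔ AgreeOff c x y := by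
  refine forall_congr' fun f => imp_congr_right fun hf => ?_
  rw [label_flip_of_ne fun h' => he (hf.congr ((h.circleOf_eq_of_avoids hf).1 h'))]

theorem agreeOff_flip_of_avoids {c : Fin D.numCrossings} {x y : D.State} {e : D.Edge}
    (h : AdjacentAt c x.1 y.1) (he : Avoids x.1 c e) :
    (AgreeOff c (flip e x) y ∧ label x e = true) ↔
      (AgreeOff c x (flip e y) ∧ label y e = false) := by
  have key : label x e = !label y e → (AgreeOff c (flip e x) y ↔ AgreeOff c x (flip e y)) := by
    intro hl
    refine forall_congr' fun f => imp_congr_right fun hf => ?_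
    by_cases hfe : circleOf x.1 f = circleOf x.1 e
    · have hfe' := (h.circleOf_eq_of_avoids hf).2 hfe
      rw [label_flip_of_eq hfe, label_flip_of_eq hfe', label_congr x hfe, label_congr y hfe', hl]
      simp
    · have hfe' := fun h' => hfe ((h.circleOf_eq_of_avoids hf).1 h')
      rw [label_flip_of_ne hfe, label_flip_of_ne hfe']
  constructor
  · rintro ⟨h1, h2⟩
    have h3 := h1 e he
    rw [label_flip_of_eq rfl, h2] at h3
    exact ⟨(key (by rw [h2, h3]; rfl)).1 h1, h3⟩
  · rintro ⟨h1, h2⟩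
    have h3 := h1 e he
    rw [label_flip_of_eq rfl, h2] at h3
    exact ⟨(key (by rw [h2, ← h3])).2 h1, h3.symm⟩

theorem mergeCoeff_not_left (p q r : Bool) :
    (if p = true then mergeCoeff (!p) q r else 0) =
      if r = false then mergeCoeff p q (!r) else 0 := by decide +revert

theorem mergeCoeff_not_right (p q r : Bool) :
    (if q = true then mergeCoeff p (!q) r else 0) =
      if r = false then mergeCoeff p q (!r) else 0 := by decide +revert

theorem splitCoeff_not_left (p q r : Bool) :
    (if p = true then splitCoeff (!p) q r else 0) =
      if q = false then splitCoeff p (!q) r else 0 := by decide +revert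

theorem splitCoeff_not_right (p q r : Bool) :
    (if p = true then splitCoeff (!p) q r else 0) =
      if r = false then splitCoeff p q (!r) else 0 := by decide +revert

/-- The matrix form of the fact that the edge maps commute with multiplication by `X` on the
circle of `e`. -/
theorem edgeCoeff_flip {c : Fin D.numCrossings} {x y : D.State} (h : AdjacentAt c x.1 y.1)
    (e : D.Edge) :
    (if label x e = true then edgeCoeff c (flip e x) y else 0) =
      if label y e = false then edgeCoeff c x (flip e y) else 0 := by
  by_cases hm : circleOf x.1 (D.inEdge (c, true)) ≠ circleOf x.1 (D.outEdge (c, true))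
  · have hm' := h.circleOf_eq_iff_ne.2 hm
    rw [edgeCoeff_merge (x := flip e x) hm hm', edgeCoeff_merge (y := flip e y) hm hm']
    by_cases he : Avoids x.1 c e
    · have he' := (h.avoids_iff e).1 he
      rw [label_flip_of_ne he.1.symm, label_flip_of_ne he.2.symm, label_flip_of_ne he'.1.symm]
      simp only [← ite_and, and_comm (a := label x e = true), and_comm (a := label y e = false),
        agreeOff_flip_of_avoids h he]
    · simp only [agreeOff_flip_left_of_not_avoids he, agreeOff_flip_right_of_not_avoids h he]
      have hye : circleOf y.1 e = circleOf y.1 (D.inEdge (c, true)) := by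
        have := mt (h.avoids_iff e).2 he
        unfold Avoids at this
        rw [← hm'] at this
        tauto
      rw [label_flip_of_eq hye.symm, label_congr y hye]
      by_cases hag : AgreeOff c x y
      · simp only [if_pos hag]
        by_cases hea : circleOf x.1 e = circleOf x.1 (D.inEdge (c, true))
        · rw [label_flip_of_eq hea.symm, label_flip_of_ne (hea ▸ hm.symm), label_congr x hea]
          exact mergeCoeff_not_left _ _ _
        · have heb : circleOf x.1 e = circleOf x.1 (D.outEdge (c, true)) := by
            unfold Avoids at he
            tauto
          rw [label_flip_of_eq heb.symm, label_flip_of_ne (heb ▸ hm), label_congr x heb]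
          exact mergeCoeff_not_right _ _ _
      · simp only [if_neg hag, ite_self]
  · have hm' := mt h.circleOf_eq_iff_ne.1 hm
    rw [not_not] at hm
    rw [edgeCoeff_split (x := flip e x) hm hm', edgeCoeff_split (y := flip e y) hm hm']
    by_cases he : Avoids x.1 c e
    · have he' := (h.avoids_iff e).1 he
      rw [label_flip_of_ne he.1.symm, label_flip_of_ne he'.1.symm, label_flip_of_ne he'.2.symm]
      simp only [← ite_and, and_comm (a := label x e = true), and_comm (a := label y e = false),
        agreeOff_flip_of_avoids h he]
    · simp only [agreeOff_flip_left_of_not_avoids he, agreeOff_flip_right_of_not_avoids h he]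
      have hxe : circleOf x.1 e = circleOf x.1 (D.inEdge (c, true)) := by
        unfold Avoids at he
        rw [← hm] at he
        tauto
      rw [label_flip_of_eq hxe.symm, label_congr x hxe]
      by_cases hag : AgreeOff c x y
      · simp only [if_pos hag]
        by_cases hea : circleOf y.1 e = circleOf y.1 (D.inEdge (c, true))
        · rw [label_flip_of_eq hea.symm, label_flip_of_ne fun h' => hm' (hea.symm.trans h'.symm),
            label_congr y hea]
          exact splitCoeff_not_left _ _ _
        · have heb : circleOf y.1 e = circleOf y.1 (D.outEdge (c, true)) := by
            have := mt (h.avoids_iff e).2 he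
            unfold Avoids at this
            tauto
          rw [label_flip_of_eq heb.symm, label_flip_of_ne fun h' => hm' (h'.trans heb),
            label_congr y heb]
          exact splitCoeff_not_right _ _ _
      · simp only [if_neg hag, ite_self]

end

variable (𝕜 : Type*) [Field 𝕜]

/-- Multiplication by `X` on the circle of an edge, for the identification of `V` with
`𝕜[X]/X²` in which `v₊` is `1` and `v₋` is `X`. -/
def mulX (e : D.Edge) : D.CKh 𝕜 →ₗ[𝕜] D.CKh 𝕜 where
  toFun f z := if label z e = false then f (flip e z) else 0
  map_add' f g := by ext z; simp only [Pi.add_apply]; split_ifs <;> simp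
  map_smul' a f := by ext z; simp only [Pi.smul_apply]; split_ifs <;> simp

theorem mulX_apply (e : D.Edge) (f : D.CKh 𝕜) (z : D.State) :
    mulX 𝕜 e f z = if label z e = false then f (flip e z) else 0 := rfl

theorem mulX_comm (e f : D.Edge) (g : D.CKh 𝕜) :
    mulX 𝕜 e (mulX 𝕜 f g) = mulX 𝕜 f (mulX 𝕜 e g) := by
  ext z
  simp only [mulX_apply]
  by_cases h : circleOf z.1 e = circleOf z.1 f
  · rw [label_flip_of_eq h, label_flip_of_eq h.symm, label_congr z h]
    cases label z f <;> simp
  · rw [label_flip_of_ne h, label_flip_of_ne (Ne.symm h), flip_comm]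
    split_ifs <;> rfl

/-- The edge map of the cube of resolutions at the crossing `c`, on all resolutions
simultaneously. -/
def edgeMap (c : Fin D.numCrossings) : D.CKh 𝕜 →ₗ[𝕜] D.CKh 𝕜 where
  toFun f y := ∑ x, if x.1 c = false ∧ y.1 = Function.update x.1 c true then
    (edgeCoeff c x y : 𝕜) * f x else 0
  map_add' f g := by
    ext y
    simp only [Pi.add_apply, ← Finset.sum_add_distrib]
    exact Finset.sum_congr rfl fun x _ => by split_ifs <;> ring
  map_smul' a f := by
    ext y
    simp only [Pi.smul_apply, smul_eq_mul, Finset.mul_sum, RingHom.id_apply]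
    exact Finset.sum_congr rfl fun x _ => by split_ifs <;> ring

theorem edgeMap_apply (c : Fin D.numCrossings) (f : D.CKh 𝕜) (y : D.State) :
    edgeMap 𝕜 c f y = ∑ x, if x.1 c = false ∧ y.1 = Function.update x.1 c true then
      (edgeCoeff c x y : 𝕜) * f x else 0 := rfl

theorem edgeMap_mulX (c : Fin D.numCrossings) (e : D.Edge) (f : D.CKh 𝕜) :
    edgeMap 𝕜 c (mulX 𝕜 e f) = mulX 𝕜 e (edgeMap 𝕜 c f) := by
  ext z
  rw [mulX_apply, edgeMap_apply, edgeMap_apply]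
  have h1 : (∑ x : D.State, if x.1 c = false ∧ z.1 = Function.update x.1 c true then
      (edgeCoeff c x z : 𝕜) * mulX 𝕜 e f x else 0) =
      ∑ x : D.State, if x.1 c = false ∧ z.1 = Function.update x.1 c true then
        (edgeCoeff c (flip e x) z : 𝕜) * mulX 𝕜 e f (flip e x) else 0 :=
    (Equiv.sum_comp (Function.Involutive.toPerm _ (flip_flip e)) fun x : D.State =>
      if x.1 c = false ∧ z.1 = Function.update x.1 c true then
      (edgeCoeff c x z : 𝕜) * mulX 𝕜 e f x else 0).symm
  have h2 : ∀ (p : Prop) [Decidable p] (g : D.State → 𝕜),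
      (if p then ∑ x, g x else 0) = ∑ x, if p then g x else 0 := by
    intro p _ g
    split_ifs <;> simp
  rw [h1, h2]
  refine Finset.sum_congr rfl fun x _ => ?_
  by_cases hx : x.1 c = false ∧ z.1 = Function.update x.1 c true
  · have hadj : AdjacentAt c x.1 z.1 := hx.2 ▸ adjacentAt_update hx.1
    have := edgeCoeff_flip hadj e
    rw [if_pos hx, flip_fst, if_pos hx, mulX_apply, label_flip_of_eq rfl, flip_flip]
    clear h1 h2
    cases h : label x e <;> cases h' : label z e <;>
      simp only [h, h', Bool.false_eq_true, if_false, if_true, reduceCtorEq] at this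
    · simp [← this]
    · simp
    · simp [this]
    · simp [this]
  · rw [if_neg hx, flip_fst, if_neg hx, ite_self]

/-- The state with all signs positive: the unit of the algebra of a resolution. -/
def oneState (S : D.Resolution) : D.State := ⟨S, fun _ => true⟩

theorem label_oneState (S : D.Resolution) (e : D.Edge) : label (oneState S) e = true := rfl

theorem eq_oneState_iff {y : D.State} {S : D.Resolution} (hy : y.1 = S) :
    y = oneState S ↔ ∀ e, label y e = true :=
  ⟨fun h e => by rw [h, label_oneState], fun h => state_ext hy h⟩

theorem eq_flip_oneState_iff {y : D.State} {S : D.Resolution} (hy : y.1 = S) (f : D.Edge) :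
    y = flip f (oneState S) ↔ ∀ e, label y e = false ↔ circleOf y.1 e = circleOf y.1 f := by
  subst hy
  have key : ∀ e, label (flip f (oneState y.1)) e = false ↔ circleOf y.1 e = circleOf y.1 f := by
    intro e
    by_cases h : circleOf y.1 e = circleOf y.1 f
    · rw [label_flip_of_eq (x := oneState y.1) h]
      simp [h, label_oneState]
    · rw [label_flip_of_ne (x := oneState y.1) h]
      simp [h, label_oneState]
  constructor
  · intro h e
    rw [← key e, ← h]
  · intro h
    refine state_ext rfl fun e => ?_
    rw [Bool.eq_iff_iff, ← not_iff_not, Bool.not_eq_true, Bool.not_eq_true, h, key]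

open scoped Classical in
/-- The basis element of an enhanced state. -/
def basis (x : D.State) : D.CKh 𝕜 := Pi.single x 1

open scoped Classical in
theorem basis_apply (x y : D.State) : basis 𝕜 x y = if y = x then 1 else 0 :=
  Pi.single_apply _ _ _

theorem mulX_basis {x : D.State} {e : D.Edge} (h : label x e = true) :
    mulX 𝕜 e (basis 𝕜 x) = basis 𝕜 (flip e x) := by
  ext z
  simp only [mulX_apply, basis_apply]
  by_cases hz : z = flip e x
  · subst hz
    simp [flip_flip, label_flip_of_eq, h]
  · have : flip e z ≠ x := fun h' => hz (by rw [← h', flip_flip])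
    simp [hz, this]

/-- The Khovanov complex is generated by the units under the operators `mulX`. -/
theorem linearMap_ext_of_mulX {F G : D.CKh 𝕜 →ₗ[𝕜] D.CKh 𝕜}
    (hF : ∀ e f, F (mulX 𝕜 e f) = mulX 𝕜 e (F f)) (hG : ∀ e f, G (mulX 𝕜 e f) = mulX 𝕜 e (G f))
    (h : ∀ S, F (basis 𝕜 (oneState S)) = G (basis 𝕜 (oneState S))) : F = G := by
  classical
  have key : ∀ (n : ℕ) (x : D.State), (Finset.univ.filter fun e => label x e = false).card ≤ n →
      F (basis 𝕜 x) = G (basis 𝕜 x) := by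
    intro n
    induction n with
    | zero =>
      intro x hx
      rw [Nat.le_zero, Finset.card_eq_zero, Finset.filter_eq_empty_iff] at hx
      rw [(eq_oneState_iff (y := x) rfl).2 fun e => by simpa using hx (Finset.mem_univ e), h]
    | succ n ih =>
      intro x hx
      by_cases hall : ∀ e, label x e = true
      · rw [(eq_oneState_iff (y := x) rfl).2 hall, h]
      · push Not at hall
        obtain ⟨e, he⟩ := hall
        rw [Ne, Bool.not_eq_true] at he
        have hcard : (Finset.univ.filter fun f => label (flip e x) f = false).card ≤ n := by
          refine Nat.lt_succ_iff.1 (lt_of_lt_of_le (Finset.card_lt_card ?_) hx)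
          rw [Finset.ssubset_iff_of_subset]
          · exact ⟨e, by simp [he], by simp [label_flip_of_eq, he]⟩
          · intro f hf
            simp only [Finset.mem_filter, Finset.mem_univ, true_and] at hf ⊢
            by_cases hfe : circleOf x.1 f = circleOf x.1 e
            · rw [label_congr x hfe, he]
            · rwa [label_flip_of_ne hfe] at hf
        have hx' : basis 𝕜 x = mulX 𝕜 e (basis 𝕜 (flip e x)) := by
          rw [mulX_basis 𝕜 (by rw [label_flip_of_eq rfl, he]; rfl), flip_flip]
        rw [hx', hF, hG, ih _ hcard]
  refine LinearMap.pi_ext' fun x => LinearMap.ext_ring ?_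
  simpa [basis] using key _ x le_rfl

theorem mulX_oneState_congr {S : D.Resolution} {e f : D.Edge} (h : circleOf S e = circleOf S f) :
    mulX 𝕜 e (basis 𝕜 (oneState S)) = mulX 𝕜 f (basis 𝕜 (oneState S)) := by
  rw [mulX_basis 𝕜 (label_oneState S e), mulX_basis 𝕜 (label_oneState S f)]
  congr 1
  refine (eq_flip_oneState_iff (S := S) rfl f).2 fun g => ?_
  have := (eq_flip_oneState_iff (y := flip e (oneState S)) rfl e).1 rfl g
  rw [this]
  exact iff_of_eq (congrArg (circleOf S g = ·) h)

theorem edgeMap_basis (c : Fin D.numCrossings) (x y : D.State) :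
    edgeMap 𝕜 c (basis 𝕜 x) y = if x.1 c = false ∧ y.1 = Function.update x.1 c true then
      (edgeCoeff c x y : 𝕜) else 0 := by
  classical
  rw [edgeMap_apply, Finset.sum_eq_single x]
  · simp [basis]
  · intro z _ hz
    simp [basis, hz]
  · simp

theorem edgeMap_oneState_of_true {c : Fin D.numCrossings} {S : D.Resolution} (h : S c = true) :
    edgeMap 𝕜 c (basis 𝕜 (oneState S)) = 0 := by
  ext y
  rw [edgeMap_basis]
  simp [oneState, h]

theorem edgeMap_oneState_merge {c : Fin D.numCrossings} {S : D.Resolution} (h : S c = false)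
    (hm : circleOf S (D.inEdge (c, true)) ≠ circleOf S (D.outEdge (c, true))) :
    edgeMap 𝕜 c (basis 𝕜 (oneState S)) =
      basis 𝕜 (oneState (Function.update S c true)) := by
  classical
  ext y
  rw [edgeMap_basis, basis_apply]
  by_cases hy : y.1 = Function.update S c true
  · have hadj : AdjacentAt c S y.1 := hy ▸ adjacentAt_update h
    have hm' := hadj.circleOf_eq_iff_ne.2 hm
    rw [if_pos ⟨h, hy⟩, edgeCoeff_merge hm hm', label_oneState, label_oneState]
    have key : y = oneState (Function.update S c true) ↔
        AgreeOff c (oneState S) y ∧ label y (D.inEdge (c, true)) = true := by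
      rw [eq_oneState_iff hy]
      refine ⟨fun h' => ⟨fun e _ => h' e, h' _⟩, fun ⟨h1, h2⟩ e => ?_⟩
      by_cases he : Avoids S c e
      · exact h1 e he
      · have := mt (hadj.avoids_iff e).2 he
        unfold Avoids at this
        rw [← hm'] at this
        rw [label_congr y (f := D.inEdge (c, true)) (by tauto), h2]
    rw [if_congr key rfl rfl]
    by_cases hag : AgreeOff c (oneState S) y
    · cases label y (D.inEdge (c, true)) <;> simp [hag, mergeCoeff]
    · simp [hag]
  · rw [if_neg fun h' => hy h'.2, if_neg fun h' => hy (by rw [h']; rfl)]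

theorem edgeMap_oneState_split {c : Fin D.numCrossings} {S : D.Resolution} (h : S c = false)
    (hm : circleOf S (D.inEdge (c, true)) = circleOf S (D.outEdge (c, true))) :
    edgeMap 𝕜 c (basis 𝕜 (oneState S)) =
      mulX 𝕜 (D.inEdge (c, true)) (basis 𝕜 (oneState (Function.update S c true))) +
      mulX 𝕜 (D.outEdge (c, true)) (basis 𝕜 (oneState (Function.update S c true))) := by
  rw [mulX_basis 𝕜 (label_oneState _ _), mulX_basis 𝕜 (label_oneState _ _)]
  classical
  ext y
  rw [edgeMap_basis, Pi.add_apply, basis_apply, basis_apply]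
  by_cases hy : y.1 = Function.update S c true
  · have hadj : AdjacentAt c S y.1 := hy ▸ adjacentAt_update h
    have hm' := fun h' => hadj.circleOf_eq_iff_ne.1 h' hm
    rw [if_pos ⟨h, hy⟩, edgeCoeff_split hm hm', label_oneState]
    have key : y = flip (D.inEdge (c, true)) (oneState (Function.update S c true)) ↔
        AgreeOff c (oneState S) y ∧ label y (D.inEdge (c, true)) = false ∧
          label y (D.outEdge (c, true)) = true := by
      rw [eq_flip_oneState_iff hy]
      constructor
      · intro h'
        refine ⟨fun e he => ?_, (h' _).2 rfl, by simpa [Ne.symm hm'] using h' (D.outEdge (c, true))⟩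
        simpa [((hadj.avoids_iff e).1 he).1, label_oneState] using h' e
      · rintro ⟨h1, h2, h3⟩ e
        by_cases ha : circleOf y.1 e = circleOf y.1 (D.inEdge (c, true))
        · simp [label_congr y ha, h2, ha]
        · by_cases hb : circleOf y.1 e = circleOf y.1 (D.outEdge (c, true))
          · simp [label_congr y hb, h3, ha]
          · have := h1 e ((hadj.avoids_iff e).2 ⟨ha, hb⟩)
            simp [this, label_oneState, ha]
    have key' : y = flip (D.outEdge (c, true)) (oneState (Function.update S c true)) ↔
        AgreeOff c (oneState S) y ∧ label y (D.inEdge (c, true)) = true ∧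
          label y (D.outEdge (c, true)) = false := by
      rw [eq_flip_oneState_iff hy]
      constructor
      · intro h'
        refine ⟨fun e he => ?_, ?_, (h' _).2 rfl⟩
        · simpa [((hadj.avoids_iff e).1 he).2, label_oneState] using h' e
        · rw [← Bool.not_eq_false, h']
          exact hm'
      · rintro ⟨h1, h2, h3⟩ e
        by_cases hb : circleOf y.1 e = circleOf y.1 (D.outEdge (c, true))
        · simp [label_congr y hb, h3, hb]
        · by_cases ha : circleOf y.1 e = circleOf y.1 (D.inEdge (c, true))
          · simp [label_congr y ha, h2, hb]
          · have := h1 e ((hadj.avoids_iff e).2 ⟨ha, hb⟩)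
            simp [this, label_oneState, hb]
    rw [if_congr key rfl rfl, if_congr key' rfl rfl]
    by_cases hag : AgreeOff c (oneState S) y
    · cases label y (D.inEdge (c, true)) <;> cases label y (D.outEdge (c, true)) <;>
        simp [hag, splitCoeff]
    · simp [hag]
  · rw [if_neg fun h' => hy h'.2, if_neg fun h' => hy (by rw [h']; rfl),
      if_neg fun h' => hy (by rw [h']; rfl), add_zero]

end Cube
end LinkDiagram

namespace LinkDiagram

/-! ### The differential squares to zero -/

section Square

variable {D : LinkDiagram}

theorem AdjacentAt.card_circle_of_ne {c : Fin D.numCrossings} {S S' : D.Resolution}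
    (h : AdjacentAt c S S')
    (hne : circleOf S (D.inEdge (c, true)) ≠ circleOf S (D.outEdge (c, true))) :
    Fintype.card (Circle S) = Fintype.card (Circle S') + 1 := by
  have := h.sum_circles hne (fun _ => (1 : ℤ)) (fun _ => 1) fun _ _ => rfl
  simp only [Finset.sum_const, Finset.card_univ, nsmul_eq_mul, mul_one] at this
  omega

theorem AdjacentAt.card_circle_of_eq {c : Fin D.numCrossings} {S S' : D.Resolution}
    (h : AdjacentAt c S S')
    (heq : circleOf S (D.inEdge (c, true)) = circleOf S (D.outEdge (c, true))) :
    Fintype.card (Circle S') = Fintype.card (Circle S) + 1 :=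
  h.symm.card_circle_of_ne (h.symm.circleOf_eq_iff_ne.1 heq)

variable (𝕜 : Type*) [Field 𝕜]

theorem mulX_add_mulX_congr {S : D.Resolution} {a b a' b' : D.Edge}
    (h : (circleOf S a = circleOf S a' ∧ circleOf S b = circleOf S b') ∨
      (circleOf S a = circleOf S b' ∧ circleOf S b = circleOf S a')) :
    mulX 𝕜 a (basis 𝕜 (oneState S)) + mulX 𝕜 b (basis 𝕜 (oneState S)) =
      mulX 𝕜 a' (basis 𝕜 (oneState S)) + mulX 𝕜 b' (basis 𝕜 (oneState S)) := by
  rcases h with ⟨h1, h2⟩ | ⟨h1, h2⟩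
  · rw [mulX_oneState_congr 𝕜 h1, mulX_oneState_congr 𝕜 h2]
  · rw [mulX_oneState_congr 𝕜 h1, mulX_oneState_congr 𝕜 h2, add_comm]

theorem edgeMap_self (c : Fin D.numCrossings) (f : D.CKh 𝕜) :
    edgeMap 𝕜 c (edgeMap 𝕜 c f) = 0 := by
  ext y
  rw [edgeMap_apply]
  refine Finset.sum_eq_zero fun x _ => ?_
  split_ifs with hx
  · rw [edgeMap_apply, Finset.sum_eq_zero, mul_zero]
    intro z _
    refine if_neg fun hz => ?_
    have := hx.1
    rw [hz.2, Function.update_self] at this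
    exact absurd this (by decide)
  · rfl

/-- The faces of the cube commute on units. The two ways around a face involve the same number of
splittings. If both ways merge first and then split, or both split first and then merge, the two
crossings are passed by the same circles in the end; in the other cases the two ways agree at
once. -/
theorem edgeMap_comm_oneState {c c' : Fin D.numCrossings} (hcc : c ≠ c') (S : D.Resolution) :
    edgeMap 𝕜 c' (edgeMap 𝕜 c (basis 𝕜 (oneState S))) =
      edgeMap 𝕜 c (edgeMap 𝕜 c' (basis 𝕜 (oneState S))) := by
  have hzero : ∀ {i j : Fin D.numCrossings}, i ≠ j → S i = true →
      edgeMap 𝕜 i (edgeMap 𝕜 j (basis 𝕜 (oneState S))) = 0 := by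
    intro i j hij hi
    have hi' : Function.update S j true i = true := by rw [Function.update_of_ne hij, hi]
    cases hj : S j
    · by_cases m : circleOf S (D.inEdge (j, true)) = circleOf S (D.outEdge (j, true))
      · rw [edgeMap_oneState_split 𝕜 hj m, map_add, edgeMap_mulX, edgeMap_mulX,
          edgeMap_oneState_of_true 𝕜 hi', map_zero, map_zero, add_zero]
      · rw [edgeMap_oneState_merge 𝕜 hj m, edgeMap_oneState_of_true 𝕜 hi']
    · rw [edgeMap_oneState_of_true 𝕜 hj, map_zero]
  cases hc : S c
  swap
  · rw [edgeMap_oneState_of_true 𝕜 hc, map_zero, hzero hcc hc]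
  cases hc' : S c'
  swap
  · rw [edgeMap_oneState_of_true 𝕜 hc', map_zero, hzero hcc.symm hc']
  have h1' : Function.update S c true c' = false := by rw [Function.update_of_ne hcc.symm, hc']
  have h1 : Function.update S c' true c = false := by rw [Function.update_of_ne hcc, hc]
  have hS : Function.update (Function.update S c' true) c true =
      Function.update (Function.update S c true) c' true := Function.update_comm hcc.symm _ _ _
  have A := adjacentAt_update hc
  have A' := adjacentAt_update hc'
  have B := adjacentAt_update h1'
  have B' := adjacentAt_update h1
  have eA := edgeMap_oneState_merge 𝕜 hc
  have eA' := edgeMap_oneState_merge 𝕜 hc'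
  have eB := edgeMap_oneState_merge 𝕜 h1'
  have eB' := edgeMap_oneState_merge 𝕜 h1
  have sA := edgeMap_oneState_split 𝕜 hc
  have sA' := edgeMap_oneState_split 𝕜 hc'
  have sB := edgeMap_oneState_split 𝕜 h1'
  have sB' := edgeMap_oneState_split 𝕜 h1
  rw [hS] at B' eB' sB'
  have nA := A.card_circle_of_ne
  have nA' := A'.card_circle_of_ne
  have nB := B.card_circle_of_ne
  have nB' := B'.card_circle_of_ne
  have kA := A.card_circle_of_eq
  have kA' := A'.card_circle_of_eq
  have kB := B.card_circle_of_eq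
  have kB' := B'.card_circle_of_eq
  have qA := A.circleOf_eq_iff_ne
  have qA' := A'.circleOf_eq_iff_ne
  have qB := B.circleOf_eq_iff_ne
  have qB' := B'.circleOf_eq_iff_ne
  have av := fun e he f => B.symm.circleOf_eq_of_avoids (e := e) (f := f) he
  unfold Avoids at av
  generalize Function.update (Function.update S c true) c' true = S₂ at *
  generalize Function.update S c true = S₁ at *
  generalize Function.update S c' true = S₁' at *
  have hmul := edgeMap_mulX 𝕜 c
  have hmul' := edgeMap_mulX 𝕜 c'
  generalize D.inEdge (c, true) = a at *
  generalize D.outEdge (c, true) = b at *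
  generalize D.inEdge (c', true) = a' at *
  generalize D.outEdge (c', true) = b' at *
  -- Counting circles leaves six of the sixteen combinations of mergings and splittings.
  by_cases mA : circleOf S a = circleOf S b <;> by_cases mB : circleOf S₁ a' = circleOf S₁ b' <;>
    by_cases mA' : circleOf S a' = circleOf S b' <;> by_cases mB' : circleOf S₁' a = circleOf S₁' b
  all_goals
    first
    | replace nA := nA mA
    | replace kA := kA mA
    first
    | replace nB := nB mB
    | replace kB := kB mB
    first
    | replace nA' := nA' mA'
    | replace kA' := kA' mA'
    first
    | replace nB' := nB' mB'
    | replace kB' := kB' mB'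
    first
    | omega
    | skip
  · rw [sA mA, sA' mA', map_add, map_add, hmul', hmul', hmul, hmul, sB mB, sB' mB']
    simp only [map_add, mulX_comm 𝕜 a, mulX_comm 𝕜 b]
    abel
  · -- Every circle through a crossing of the face ends up in the same circle.
    have hab := qB'.2 mB'
    have hab' := qB.2 mB
    have ne := fun h => qA.1 h mA
    rw [sA mA, sA' mA', map_add, map_add, hmul', hmul', hmul, hmul, eB mB, eB' mB']
    refine mulX_add_mulX_congr 𝕜 (.inl ?_)
    have haa : circleOf S₂ a = circleOf S₂ a' := by
      by_contra hne
      exact ne ((av a ⟨hne, hab' ▸ hne⟩ b).2 hab)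
    exact ⟨haa, hab.symm.trans (haa.trans hab')⟩
  · rw [sA mA, eA' mA', map_add, hmul', hmul', eB mB, sB' mB']
  · rw [eA mA, sA' mA', map_add, hmul, hmul, sB mB, eB' mB']
  · -- The merged circle is split by either crossing into the same two circles.
    have hab := qA.2 mA
    have ne := fun h => qB'.1 h mB'
    rw [eA mA, eA' mA', sB mB, sB' mB']
    have h1 : circleOf S₂ a = circleOf S₂ a' ∨ circleOf S₂ a = circleOf S₂ b' := by
      by_contra hne
      rw [not_or] at hne
      exact ne ((av a hne b).1 hab)
    have h2 : circleOf S₂ b = circleOf S₂ a' ∨ circleOf S₂ b = circleOf S₂ b' := by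
      by_contra hne
      rw [not_or] at hne
      exact ne ((av b hne a).1 hab.symm).symm
    refine (mulX_add_mulX_congr 𝕜 ?_).symm
    rcases h1 with h1 | h1 <;> rcases h2 with h2 | h2
    · exact absurd (h1.trans h2.symm) ne
    · exact .inl ⟨h1, h2⟩
    · exact .inr ⟨h1, h2⟩
    · exact absurd (h1.trans h2.symm) ne
  · rw [eA mA, eA' mA', eB mB, eB' mB']

theorem edgeMap_comm (c c' : Fin D.numCrossings) (f : D.CKh 𝕜) :
    edgeMap 𝕜 c' (edgeMap 𝕜 c f) = edgeMap 𝕜 c (edgeMap 𝕜 c' f) := by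
  rcases eq_or_ne c c' with rfl | hcc
  · rfl
  have : edgeMap 𝕜 c' ∘ₗ edgeMap 𝕜 c = edgeMap 𝕜 c ∘ₗ edgeMap 𝕜 c' :=
    linearMap_ext_of_mulX 𝕜 (fun e f => by simp [edgeMap_mulX]) (fun e f => by simp [edgeMap_mulX])
      (edgeMap_comm_oneState 𝕜 hcc)
  exact LinearMap.congr_fun this f

/-- The sign of an edge of the cube at the crossing `c`, as a diagonal operator. -/
def signMap (c : Fin D.numCrossings) : D.CKh 𝕜 →ₗ[𝕜] D.CKh 𝕜 where
  toFun f x := (-1) ^ (Finset.univ.filter fun i => i < c ∧ x.1 i = true).card * f x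
  map_add' f g := by ext x; simp only [Pi.add_apply]; ring
  map_smul' a f := by ext x; simp only [Pi.smul_apply, smul_eq_mul, RingHom.id_apply]; ring

theorem signMap_apply (c : Fin D.numCrossings) (f : D.CKh 𝕜) (x : D.State) :
    signMap 𝕜 c f x = (-1) ^ (Finset.univ.filter fun i => i < c ∧ x.1 i = true).card * f x := rfl

theorem d_apply (f : D.CKh 𝕜) (y : D.State) : D.d 𝕜 f y = ∑ x, (dCoeff x y : 𝕜) * f x := rfl

theorem d_eq_sum (f : D.CKh 𝕜) : D.d 𝕜 f = ∑ c, edgeMap 𝕜 c (signMap 𝕜 c f) := by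
  ext y
  rw [d_apply, Finset.sum_apply]
  simp only [edgeMap_apply]
  rw [Finset.sum_comm]
  refine Finset.sum_congr rfl fun x _ => ?_
  rw [dCoeff, Int.cast_sum, Finset.sum_mul]
  refine Finset.sum_congr rfl fun c _ => ?_
  split_ifs
  · rw [signMap_apply]
    push_cast
    ring
  · simp

theorem card_filter_update {S : D.Resolution} {c : Fin D.numCrossings} (h : S c = false)
    (p : Fin D.numCrossings → Prop) [DecidablePred p] :
    (Finset.univ.filter fun i => p i ∧ Function.update S c true i = true).card =
      (Finset.univ.filter fun i => p i ∧ S i = true).card + if p c then 1 else 0 := by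
  have heq : ∀ i, i ≠ c → ((p i ∧ Function.update S c true i = true) ↔ (p i ∧ S i = true)) :=
    fun i hi => by rw [Function.update_of_ne hi]
  by_cases hp : p c
  · rw [if_pos hp, ← Finset.card_insert_of_notMem (a := c) (by simp [h])]
    congr 1
    ext i
    by_cases hi : i = c
    · subst hi
      simp [hp]
    · simp [hi]
  · rw [if_neg hp, add_zero]
    congr 1
    ext i
    by_cases hi : i = c
    · subst hi
      simp [hp]
    · simp [hi]

theorem signMap_edgeMap (c c' : Fin D.numCrossings) (f : D.CKh 𝕜) :
    signMap 𝕜 c' (edgeMap 𝕜 c f) =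
      (if c < c' then -1 else 1 : 𝕜) • edgeMap 𝕜 c (signMap 𝕜 c' f) := by
  ext y
  rw [signMap_apply, Pi.smul_apply, edgeMap_apply, edgeMap_apply, smul_eq_mul, Finset.mul_sum,
    Finset.mul_sum]
  refine Finset.sum_congr rfl fun x _ => ?_
  split_ifs with h1 h2 h2
  · rw [h1.2, card_filter_update h1.1, if_pos h2, signMap_apply]
    ring
  · rw [h1.2, card_filter_update h1.1, if_neg h2, signMap_apply]
    ring
  · simp
  · simp

theorem d_d (f : D.CKh 𝕜) : D.d 𝕜 (D.d 𝕜 f) = 0 := by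
  have h : D.d 𝕜 (D.d 𝕜 f) = ∑ q : Fin D.numCrossings × Fin D.numCrossings,
      (if q.2 < q.1 then -1 else 1 : 𝕜) •
        edgeMap 𝕜 q.1 (edgeMap 𝕜 q.2 (signMap 𝕜 q.1 (signMap 𝕜 q.2 f))) := by
    rw [d_eq_sum, Fintype.sum_prod_type]
    refine Finset.sum_congr rfl fun c _ => ?_
    rw [d_eq_sum, map_sum, map_sum]
    refine Finset.sum_congr rfl fun c' _ => ?_
    rw [signMap_edgeMap, map_smul]
  have hs : ∀ c c', signMap 𝕜 c (signMap 𝕜 c' f) = signMap 𝕜 c' (signMap 𝕜 c f) := by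
    intro c c'
    ext x
    simp only [signMap_apply]
    ring
  rw [h]
  refine Finset.sum_involution (fun q _ => q.swap) ?_ ?_ (fun _ _ => Finset.mem_univ _)
    fun q _ => q.swap_swap
  · rintro ⟨c, c'⟩ -
    simp only [Prod.swap]
    rw [edgeMap_comm 𝕜 c c', hs c' c, ← add_smul]
    rcases lt_trichotomy c c' with hlt | rfl | hlt
    · simp [hlt, hlt.not_gt]
    · rw [edgeMap_self, smul_zero]
    · simp [hlt, hlt.not_gt]
  · rintro ⟨c, c'⟩ - hne heq
    obtain rfl : c' = c := congrArg Prod.fst heq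
    simp [edgeMap_self] at hne

end Square

/-! ### Degrees of the differential -/

section Degrees

variable {D : LinkDiagram}

theorem exists_edgeCoeff_ne_zero {x y : D.State} (h : dCoeff x y ≠ 0) :
    ∃ c, x.1 c = false ∧ y.1 = Function.update x.1 c true ∧ edgeCoeff c x y ≠ 0 := by
  obtain ⟨c, -, hc⟩ := Finset.exists_ne_zero_of_sum_ne_zero h
  split_ifs at hc with h'
  · exact ⟨c, h'.1, h'.2, right_ne_zero_of_mul hc⟩
  · exact absurd rfl hc

theorem agreeOff_of_edgeCoeff_ne_zero {c : Fin D.numCrossings} {x y : D.State}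
    (h : edgeCoeff c x y ≠ 0) : AgreeOff c x y := by
  by_contra hag
  simp only [AgreeOff, Avoids, label, and_imp] at hag
  exact h (if_neg hag)

theorem weight_eq_add_one {c : Fin D.numCrossings} {x y : D.State} (h : x.1 c = false)
    (hy : y.1 = Function.update x.1 c true) : D.weight y.1 = D.weight x.1 + 1 := by
  have := card_filter_update h (fun _ => True)
  simpa [weight, hy] using this

theorem hDeg_of_dCoeff_ne_zero {x y : D.State} (h : dCoeff x y ≠ 0) : hDeg y = hDeg x + 1 := by
  obtain ⟨c, hx, hy, -⟩ := exists_edgeCoeff_ne_zero h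
  rw [hDeg, hDeg, weight_eq_add_one hx hy]
  push_cast
  ring

theorem sgn_mergeCoeff {p q r : Bool} (h : mergeCoeff p q r ≠ 0) :
    sgn r = sgn p + sgn q - 1 := by
  revert h
  decide +revert

theorem sgn_splitCoeff {p q r : Bool} (h : splitCoeff p q r ≠ 0) :
    sgn q + sgn r = sgn p - 1 := by
  revert h
  decide +revert

theorem qDeg_of_dCoeff_ne_zero {x y : D.State} (h : dCoeff x y ≠ 0) : qDeg y = qDeg x := by
  obtain ⟨c, hx, hy, hne⟩ := exists_edgeCoeff_ne_zero h
  have hadj : AdjacentAt c x.1 y.1 := hy ▸ adjacentAt_update hx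
  have hag := agreeOff_of_edgeCoeff_ne_zero hne
  have hsum : ∑ C, sgn (y.2 C) = ∑ C, sgn (x.2 C) - 1 := by
    classical
    by_cases hm : circleOf x.1 (D.inEdge (c, true)) = circleOf x.1 (D.outEdge (c, true))
    · have hm' := mt hadj.circleOf_eq_iff_ne.1 (not_not.2 hm)
      rw [edgeCoeff_split hm hm', if_pos hag] at hne
      have h1 := hadj.symm.sum_circles hm' (fun C => sgn (y.2 C)) (fun C => sgn (x.2 C))
        fun e he => congrArg sgn (hag e ((hadj.avoids_iff e).2 he))
      have h2 := sgn_splitCoeff hne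
      simp only [label] at h2
      linarith
    · have hm' := hadj.circleOf_eq_iff_ne.2 hm
      rw [edgeCoeff_merge hm hm', if_pos hag] at hne
      have h1 := hadj.sum_circles hm (fun C => sgn (x.2 C)) (fun C => sgn (y.2 C))
        fun e he => congrArg sgn (hag e he).symm
      have h2 := sgn_mergeCoeff hne
      simp only [label] at h2
      linarith
  rw [qDeg, qDeg, hsum, weight_eq_add_one hx hy]
  push_cast
  ring

theorem AdjacentAt.encloses_iff_of_avoids {c : Fin D.numCrossings} {S S' : D.Resolution}
    (h : AdjacentAt c S S') {e : D.Edge} (he : Avoids S c e) (r : D.Region) :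
    Encloses (circleOf S e) r ↔ Encloses (circleOf S' e) r :=
  encloses_congr (fun f => by
    rw [eq_comm, ← h.circleOf_eq_of_avoids he, eq_comm]) r

theorem sgn_mergeCoeff_le {p q r : Bool} (h : mergeCoeff p q r ≠ 0) (P Q R : Prop) [Decidable P]
    [Decidable Q] [Decidable R] (hR : R ↔ ¬ (P ↔ Q)) :
    (if R then sgn r else 0) ≤ (if P then sgn p else 0) + (if Q then sgn q else 0) := by
  by_cases hP : P <;> by_cases hQ : Q <;> simp only [hR, hP, hQ] <;> revert h <;> decide +revert

theorem sgn_splitCoeff_le {p q r : Bool} (h : splitCoeff p q r ≠ 0) (P Q R : Prop) [Decidable P]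
    [Decidable Q] [Decidable R] (hP : P ↔ ¬ (Q ↔ R)) :
    (if Q then sgn q else 0) + (if R then sgn r else 0) ≤ (if P then sgn p else 0) := by
  by_cases hQ : Q <;> by_cases hR : R <;> simp only [hP, hQ, hR] <;> revert h <;> decide +revert

/-- The differential does not increase the winding number around any puncture. This holds because
the interior of the circle that is merged from two others, or split into them, is the symmetric
difference of their interiors. -/
theorem gDeg_le_of_dCoeff_ne_zero {ι : Type} (place : ι → D.Region) {x y : D.State}
    (h : dCoeff x y ≠ 0) : gDeg place y ≤ gDeg place x := by
  classical
  obtain ⟨c, hx, hy, hne⟩ := exists_edgeCoeff_ne_zero h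
  have hadj : AdjacentAt c x.1 y.1 := hy ▸ adjacentAt_update hx
  have hag := agreeOff_of_edgeCoeff_ne_zero hne
  intro p
  have hoff : ∀ e, Avoids x.1 c e →
      (if Encloses (circleOf x.1 e) (place p) then sgn (x.2 (circleOf x.1 e)) else 0) =
        if Encloses (circleOf y.1 e) (place p) then sgn (y.2 (circleOf y.1 e)) else 0 := by
    intro e he
    rw [if_congr (hadj.encloses_iff_of_avoids he (place p)) rfl rfl]
    have : y.2 (circleOf y.1 e) = x.2 (circleOf x.1 e) := hag e he
    rw [this]
  change (∑ C, if Encloses C (place p) then sgn (y.2 C) else 0) ≤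
    ∑ C, if Encloses C (place p) then sgn (x.2 C) else 0
  by_cases hm : circleOf x.1 (D.inEdge (c, true)) = circleOf x.1 (D.outEdge (c, true))
  · have hm' := mt hadj.circleOf_eq_iff_ne.1 (not_not.2 hm)
    rw [edgeCoeff_split hm hm', if_pos hag] at hne
    have h1 := hadj.symm.sum_circles hm'
      (fun C => if Encloses C (place p) then sgn (y.2 C) else 0)
      (fun C => if Encloses C (place p) then sgn (x.2 C) else 0)
      fun e he => (hoff e ((hadj.avoids_iff e).2 he)).symm
    have h2 := sgn_splitCoeff_le hne _ _ _
      (encloses_merge hm' (hadj.symm.circleOf_eq_strand_iff hm) (place p))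
    simp only [label] at h2
    linarith
  · have hm' := hadj.circleOf_eq_iff_ne.2 hm
    rw [edgeCoeff_merge hm hm', if_pos hag] at hne
    have h1 := hadj.sum_circles hm
      (fun C => if Encloses C (place p) then sgn (x.2 C) else 0)
      (fun C => if Encloses C (place p) then sgn (y.2 C) else 0) hoff
    have h2 := sgn_mergeCoeff_le hne _ _ _
      (encloses_merge hm (hadj.circleOf_eq_strand_iff hm') (place p))
    simp only [label] at h2
    linarith

end Degrees
end LinkDiagram

/-! ### The spectral sequence of a filtered complex -/

/-- The homology of a short complex of modules is `W / N` if `W` maps to the cycles, reaching every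
homology class, and `N` is the preimage of the boundaries. -/
def ModuleCat.homologyIsoQuotient {R : Type u} [CommRing R] (S : ShortComplex (ModuleCat.{u} R))
    {W : Type u} [AddCommGroup W] [Module R W] (N : Submodule R W) (s : W →ₗ[R] S.X₂)
    (hs : ∀ w, S.g.hom (s w) = 0)
    (hsurj : ∀ b, S.g.hom b = 0 → ∃ w a, b = s w + S.f.hom a)
    (hN : ∀ w, w ∈ N ↔ ∃ a, s w = S.f.hom a) : S.homology ≅ ModuleCat.of R (W ⧸ N) :=
  let φ : W →ₗ[R] (LinearMap.ker S.g.hom ⧸ LinearMap.range S.moduleCatToCycles) :=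
    (Submodule.mkQ _).comp (s.codRestrict _ hs)
  have hφ : Function.Surjective φ := by
    rintro ⟨⟨b, hb⟩⟩
    obtain ⟨w, a, rfl⟩ := hsurj b hb
    refine ⟨w, ?_⟩
    refine (Submodule.Quotient.eq _).2 ⟨-a, Subtype.ext ?_⟩
    change S.f.hom (-a) = s w - (s w + S.f.hom a)
    rw [map_neg, sub_add_cancel_left]
  have hker : LinearMap.ker φ = N := by
    ext w
    rw [hN, LinearMap.mem_ker]
    refine (Submodule.Quotient.mk_eq_zero _).trans ?_
    constructor
    · rintro ⟨a, ha⟩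
      exact ⟨a, (congrArg Subtype.val ha).symm⟩
    · rintro ⟨a, ha⟩
      exact ⟨a, Subtype.ext ha.symm⟩
  S.moduleCatHomologyIso ≪≫ LinearEquiv.toModuleIso
    ((φ.quotKerEquivOfSurjective hφ).symm.trans (Submodule.quotEquivOfEq _ _ hker))

/-- A complex with an ascending filtration, given inside an ambient module `C` by its pieces
`F p i j` of filtration degree at most `p`, homological degree `i`, and a further degree `j`. -/
structure FilteredComplex (𝕜 C : Type*) [Field 𝕜] [AddCommGroup C] [Module 𝕜 C] where
  δ : C →ₗ[𝕜] C
  δ_δ : ∀ x, δ (δ x) = 0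
  F : ℤ → ℤ → ℤ → Submodule 𝕜 C
  mono : ∀ i j, Monotone fun p => F p i j
  map_mem : ∀ p i j, ∀ x ∈ F p i j, δ x ∈ F p (i + 1) j

namespace FilteredComplex

variable {𝕜 C : Type u} [Field 𝕜] [AddCommGroup C] [Module 𝕜 C] (K : FilteredComplex 𝕜 C)

/-- The approximate cycles: elements whose differential lies `r` steps lower in the filtration. -/
def Z (r p i j : ℤ) : Submodule 𝕜 C := K.F p i j ⊓ (K.F (p - r) (i + 1) j).comap K.δ

/-- What is divided out on page `r`: approximate cycles from the next lower step of the filtration,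
and boundaries of elements from at most `r - 1` steps higher. -/
def N (r p i j : ℤ) : Submodule 𝕜 C :=
  (K.F (p - 1) i j ⊓ (K.F (p - r) (i + 1) j).comap K.δ) ⊔
    (K.F (p + r - 1) (i - 1) j ⊓ (K.F p i j).comap K.δ).map K.δ

/-- The entries of the pages. -/
abbrev E (r p i j : ℤ) : Type u := ↥(K.Z r p i j) ⧸ (K.N r p i j).submoduleOf (K.Z r p i j)

variable {K}

theorem mem_Z {r p i j : ℤ} {x : C} :
    x ∈ K.Z r p i j ↔ x ∈ K.F p i j ∧ K.δ x ∈ K.F (p - r) (i + 1) j := Iff.rfl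

theorem mem_N {r p i j : ℤ} {x : C} : x ∈ K.N r p i j ↔
    ∃ u v, (u ∈ K.F (p - 1) i j ∧ K.δ u ∈ K.F (p - r) (i + 1) j) ∧
      (v ∈ K.F (p + r - 1) (i - 1) j ∧ K.δ v ∈ K.F p i j) ∧ u + K.δ v = x := by
  rw [N, Submodule.mem_sup]
  constructor
  · rintro ⟨u, hu, _, ⟨v, hv, rfl⟩, rfl⟩
    exact ⟨u, v, hu, hv, rfl⟩
  · rintro ⟨u, v, hu, hv, rfl⟩
    exact ⟨u, hu, _, ⟨v, hv, rfl⟩, rfl⟩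

theorem δ_mem_Z {r p i j p' i' j' : ℤ} (h : (p, i, j) + (-r, 1, 0) = (p', i', j')) {x : C}
    (hx : x ∈ K.Z r p i j) : K.δ x ∈ K.Z r p' i' j' := by
  simp only [Prod.mk_add_mk, Prod.mk.injEq] at h
  obtain ⟨rfl, rfl, rfl⟩ := h
  rw [mem_Z] at hx ⊢
  rw [add_zero, ← sub_eq_add_neg, K.δ_δ]
  exact ⟨hx.2, zero_mem _⟩

theorem δ_mem_N {r p i j p' i' j' : ℤ} (h : (p, i, j) + (-r, 1, 0) = (p', i', j')) {x : C}
    (hx : x ∈ K.N r p i j) : K.δ x ∈ K.N r p' i' j' := by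
  simp only [Prod.mk_add_mk, Prod.mk.injEq] at h
  obtain ⟨rfl, rfl, rfl⟩ := h
  obtain ⟨u, v, hu, hv, rfl⟩ := mem_N.1 hx
  refine mem_N.2 ⟨0, u, ⟨zero_mem _, by simp⟩, ⟨?_, ?_⟩, by simp [K.δ_δ]⟩
  · rw [add_zero, add_sub_cancel_right, show p + -r + r - 1 = p - 1 by ring]
    exact hu.1
  · rw [add_zero, ← sub_eq_add_neg]
    exact hu.2

/-- The differential of page `r`, induced by `δ`. -/
def dE {r p i j p' i' j' : ℤ} (h : (p, i, j) + (-r, 1, 0) = (p', i', j')) :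
    K.E r p i j →ₗ[𝕜] K.E r p' i' j' :=
  Submodule.mapQ _ _ (K.δ.restrict fun _ hx => δ_mem_Z h hx) fun _ hx => δ_mem_N h hx

theorem dE_mk {r p i j p' i' j' : ℤ} (h : (p, i, j) + (-r, 1, 0) = (p', i', j')) {x : C}
    (hx : x ∈ K.Z r p i j) :
    dE h (Submodule.Quotient.mk ⟨x, hx⟩) = Submodule.Quotient.mk ⟨K.δ x, δ_mem_Z h hx⟩ := rfl

variable (K)

/-- The pages of the spectral sequence. -/
def page (r : ℤ) :
    HomologicalComplex (ModuleCat.{u} 𝕜) (ComplexShape.up' ((-r, 1, 0) : ℤ × ℤ × ℤ)) where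
  X a := ModuleCat.of 𝕜 (K.E r a.1 a.2.1 a.2.2)
  d a b := if h : a + (-r, 1, 0) = b then ModuleCat.ofHom (dE h) else 0
  shape a b h := dif_neg h
  d_comp_d' a b c hab hbc := by
    have hab' : a + (-r, 1, 0) = b := hab
    have hbc' : b + (-r, 1, 0) = c := hbc
    rw [dif_pos hab', dif_pos hbc', ← ModuleCat.ofHom_comp]
    refine ModuleCat.hom_ext (LinearMap.ext ?_)
    rintro ⟨⟨x, hx⟩⟩
    refine (Submodule.Quotient.mk_eq_zero _).2 ?_
    change K.δ (K.δ x) ∈ K.N r c.1 c.2.1 c.2.2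
    rw [K.δ_δ]
    exact zero_mem _

theorem page_d {r : ℤ} {a b : ℤ × ℤ × ℤ} (h : a + (-r, 1, 0) = b) :
    (K.page r).d a b = ModuleCat.ofHom (dE h) := dif_pos h

variable {K}

theorem Z_succ_le (r p i j : ℤ) : K.Z (r + 1) p i j ≤ K.Z r p i j := fun _ hx =>
  ⟨hx.1, K.mono _ _ (by omega) hx.2⟩

/-- The approximate cycles for page `r + 1`, mapped to page `r`. -/
def toE (r p i j : ℤ) : ↥(K.Z (r + 1) p i j) →ₗ[𝕜] K.E r p i j :=
  (Submodule.mkQ ((K.N r p i j).submoduleOf (K.Z r p i j))).comp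
    (Submodule.inclusion (Z_succ_le r p i j))

theorem toE_apply {r p i j : ℤ} (w : ↥(K.Z (r + 1) p i j)) :
    toE r p i j w = Submodule.Quotient.mk ⟨w.1, Z_succ_le r p i j w.2⟩ := rfl

theorem mk_eq_mk_iff {r p i j : ℤ} {x y : C} (hx : x ∈ K.Z r p i j) (hy : y ∈ K.Z r p i j) :
    (Submodule.Quotient.mk ⟨x, hx⟩ : K.E r p i j) = Submodule.Quotient.mk ⟨y, hy⟩ ↔
      x - y ∈ K.N r p i j := Submodule.Quotient.eq _

theorem mk_eq_zero_iff {r p i j : ℤ} {x : C} (hx : x ∈ K.Z r p i j) :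
    (Submodule.Quotient.mk ⟨x, hx⟩ : K.E r p i j) = 0 ↔ x ∈ K.N r p i j :=
  Submodule.Quotient.mk_eq_zero _

theorem dE_toE {r p i j p' i' j' : ℤ} (h : (p, i, j) + (-r, 1, 0) = (p', i', j'))
    (w : ↥(K.Z (r + 1) p i j)) : dE h (toE r p i j w) = 0 := by
  obtain ⟨x, hx⟩ := w
  rw [toE_apply, dE_mk, mk_eq_zero_iff]
  simp only [Prod.mk_add_mk, Prod.mk.injEq] at h
  obtain ⟨rfl, rfl, rfl⟩ := h
  refine mem_N.2 ⟨K.δ x, 0, ⟨?_, by simp [K.δ_δ]⟩, by simp, by simp⟩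
  have := hx.2
  rwa [add_zero, show p + -r - 1 = p - (r + 1) by ring]

theorem exists_of_dE_eq_zero {r p i j p' i' j' : ℤ} (h : (p, i, j) + (-r, 1, 0) = (p', i', j'))
    (b : K.E r p i j) (hb : dE h b = 0) : ∃ w, b = toE r p i j w := by
  obtain ⟨⟨x, hx⟩, rfl⟩ := Submodule.Quotient.mk_surjective _ b
  rw [dE_mk, mk_eq_zero_iff] at hb
  simp only [Prod.mk_add_mk, Prod.mk.injEq] at h
  obtain ⟨rfl, rfl, rfl⟩ := h
  obtain ⟨u, v, hu, hv, hx'⟩ := mem_N.1 hb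
  rw [add_zero] at *
  have hv1 : v ∈ K.F (p - 1) i j := by
    have := hv.1
    rwa [add_sub_cancel_right, show p + -r + r - 1 = p - 1 by ring] at this
  have hw : x - v ∈ K.Z (r + 1) p i j := by
    refine ⟨sub_mem hx.1 (K.mono _ _ (by omega) hv1), ?_⟩
    change K.δ (x - v) ∈ K.F (p - (r + 1)) (i + 1) j
    rw [map_sub, ← hx', add_sub_cancel_right, show p - (r + 1) = p + -r - 1 by ring]
    exact hu.1
  refine ⟨⟨x - v, hw⟩, ?_⟩
  rw [toE_apply, mk_eq_mk_iff, sub_sub_cancel]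
  exact mem_N.2 ⟨v, 0, ⟨hv1, hv.2⟩, by simp, by simp⟩

theorem mem_N_succ_iff {r p i j p' i' j' : ℤ} (h : (p', i', j') + (-r, 1, 0) = (p, i, j))
    (w : ↥(K.Z (r + 1) p i j)) :
    w.1 ∈ K.N (r + 1) p i j ↔ ∃ a : K.E r p' i' j', toE r p i j w = dE h a := by
  obtain ⟨x, hx⟩ := w
  have h' := h
  simp only [Prod.mk_add_mk, Prod.mk.injEq, add_zero] at h'
  obtain ⟨h1, h2, h3⟩ := h'
  obtain rfl : j = j' := h3.symm
  obtain rfl : p' = p + r := by omega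
  obtain rfl : i' = i - 1 := by omega
  constructor
  · intro hN
    obtain ⟨u, v, hu, hv, rfl⟩ := mem_N.1 hN
    have hvZ : v ∈ K.Z r (p + r) (i - 1) j := by
      rw [mem_Z, add_sub_cancel_right, sub_add_cancel]
      rw [show p + (r + 1) - 1 = p + r by ring] at hv
      exact hv
    refine ⟨Submodule.Quotient.mk ⟨v, hvZ⟩, ?_⟩
    rw [toE_apply, dE_mk, mk_eq_mk_iff, add_sub_cancel_right]
    exact mem_N.2 ⟨u, 0, ⟨hu.1, K.mono _ _ (by omega) hu.2⟩, by simp, by simp⟩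
  · rintro ⟨a, ha⟩
    obtain ⟨⟨y, hy⟩, rfl⟩ := Submodule.Quotient.mk_surjective _ a
    rw [toE_apply, dE_mk, mk_eq_mk_iff] at ha
    obtain ⟨u, v, hu, hv, hxy⟩ := mem_N.1 ha
    have hy2 := (mem_Z.1 hy).2
    rw [add_sub_cancel_right, sub_add_cancel] at hy2
    have hxuv : x = u + K.δ (y + v) := by
      rw [map_add, add_comm (K.δ y), ← add_assoc, hxy, sub_add_cancel]
    refine mem_N.2 ⟨u, y + v, ⟨hu.1, ?_⟩, ⟨add_mem ?_ ?_, ?_⟩, hxuv.symm⟩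
    · have : K.δ u = K.δ x := by rw [hxuv, map_add, K.δ_δ, add_zero]
      rw [this]
      exact hx.2
    · rw [show p + (r + 1) - 1 = p + r by ring]
      exact hy.1
    · exact K.mono _ _ (by omega) hv.1
    · rw [map_add]
      exact add_mem hy2 hv.2

variable (K)

/-- The homology of each page is the next page. -/
def pageHomologyIso (r p i j : ℤ) :
    (K.page r).homology (p, i, j) ≅ ModuleCat.of 𝕜 (K.E (r + 1) p i j) :=
  have hprev : (p + r, i - 1, j) + (-r, 1, 0) = (p, i, j) := by ext <;> simp
  have hnext : (p, i, j) + (-r, 1, 0) = (p - r, i + 1, j) := by ext <;> simp [sub_eq_add_neg]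
  have hf : (K.page r).d (p + r, i - 1, j) (p, i, j) = ModuleCat.ofHom (dE hprev) :=
    K.page_d hprev
  have hg : (K.page r).d (p, i, j) (p - r, i + 1, j) = ModuleCat.ofHom (dE hnext) :=
    K.page_d hnext
  ShortComplex.homologyMapIso ((K.page r).isoSc' _ _ _ (ComplexShape.prev_eq' _ hprev)
    (ComplexShape.next_eq' _ hnext)) ≪≫
  ModuleCat.homologyIsoQuotient ((K.page r).sc' (p + r, i - 1, j) (p, i, j) (p - r, i + 1, j))
    ((K.N (r + 1) p i j).submoduleOf (K.Z (r + 1) p i j)) (toE r p i j)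
    (fun w => (congrArg (fun f => f.hom (toE r p i j w)) hg).trans (dE_toE hnext w))
    (fun b hb => by
      obtain ⟨w, hw⟩ := exists_of_dE_eq_zero hnext b
        ((congrArg (fun f => f.hom b) hg).symm.trans hb)
      exact ⟨w, 0, by rw [map_zero, add_zero]; exact hw⟩)
    (fun w => (mem_N_succ_iff hprev w).trans (exists_congr fun a => by
      have := congrArg (fun f => f.hom a) hf
      exact iff_of_eq (congrArg (toE r p i j w = ·) this.symm)))

/-- The spectral sequence of a filtered complex. -/
def spectralSequence : FilteredSpectralSequence 𝕜 where
  page r _ := K.page r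
  iso r r' a h _ := K.pageHomologyIso r a.1 a.2.1 a.2.2 ≪≫
    eqToIso (by rw [h]; rfl)

theorem subsingleton_E_of_eq_bot {r p i j : ℤ} (h : K.F p i j = ⊥) :
    Subsingleton (K.E r p i j) := by
  refine Submodule.Quotient.subsingleton_iff.2 (top_le_iff.1 ?_)
  rintro ⟨x, hx⟩ -
  obtain rfl : x = 0 := by
    have := hx.1
    rwa [h] at this
  exact zero_mem _

theorem subsingleton_E_of_eq {r p i j : ℤ} (h : K.F (p - 1) i j = K.F p i j) :
    Subsingleton (K.E r p i j) := by
  refine Submodule.Quotient.subsingleton_iff.2 (top_le_iff.1 ?_)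
  rintro ⟨x, hx⟩ -
  exact mem_N.2 ⟨x, 0, ⟨h ▸ hx.1, hx.2⟩, by simp, by simp⟩

theorem page_d_eq_zero_of_subsingleton_right {r : ℤ} (a b : ℤ × ℤ × ℤ)
    (h : a + (-r, 1, 0) = b → Subsingleton (K.E r b.1 b.2.1 b.2.2)) : (K.page r).d a b = 0 := by
  by_cases hab : a + (-r, 1, 0) = b
  · have := h hab
    refine ModuleCat.hom_ext (LinearMap.ext fun x => ?_)
    exact Subsingleton.elim (α := K.E r b.1 b.2.1 b.2.2) _ _
  · exact (K.page r).shape _ _ hab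

theorem page_d_eq_zero_of_subsingleton_left {r : ℤ} (a b : ℤ × ℤ × ℤ)
    (h : a + (-r, 1, 0) = b → Subsingleton (K.E r a.1 a.2.1 a.2.2)) : (K.page r).d a b = 0 := by
  by_cases hab : a + (-r, 1, 0) = b
  · have := h hab
    refine ModuleCat.hom_ext (LinearMap.ext fun x => ?_)
    obtain rfl : x = 0 := Subsingleton.elim (α := K.E r a.1 a.2.1 a.2.2) x 0
    rw [map_zero, map_zero]
  · exact (K.page r).shape _ _ hab

/-- The spectral sequence of a filtered complex with a finite filtration, whose largest step is
`top`, converges to the homology of the complex, given here by modules `M i j` with surjections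
`ψ i j` from the cycles whose kernels are the boundaries. -/
theorem convergesTo (top : ℤ → ℤ → Submodule 𝕜 C) {s t : ℤ}
    (hs : ∀ p ≤ s, ∀ i j, K.F p i j = ⊥) (ht : ∀ p, t ≤ p → ∀ i j, K.F p i j = top i j)
    (M : ℤ → ℤ → Type u) [∀ i j, AddCommGroup (M i j)] [∀ i j, Module 𝕜 (M i j)]
    (Φ : ∀ i j : ℤ, ℤ → Submodule 𝕜 (M i j))
    (ψ : ∀ i j, ↥(top i j ⊓ LinearMap.ker K.δ) →ₗ[𝕜] M i j)
    (hψ : ∀ i j, Function.Surjective (ψ i j))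
    (hker : ∀ i j z, ψ i j z = 0 ↔ ∃ b ∈ top (i - 1) j, K.δ b = z.1)
    (hΦ : ∀ i j p, Φ i j p =
      ((K.F p i j).submoduleOf (top i j ⊓ LinearMap.ker K.δ)).map (ψ i j)) :
    K.spectralSequence.ConvergesTo M Φ := by
  have hFtop : ∀ p i j, K.F p i j ≤ top i j := fun p i j => by
    rw [← ht (max p t) (le_max_right _ _) i j]
    exact K.mono i j (le_max_left _ _)
  have hmono : ∀ i j, Monotone (Φ i j) := by
    intro i j p q hpq
    rw [hΦ, hΦ]
    exact Submodule.map_mono (Submodule.comap_mono (K.mono i j hpq))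
  refine ⟨fun i j => ⟨hmono i j, ⟨s, ?_⟩, ⟨t, ?_⟩⟩, fun p i j => ?_⟩
  · rw [hΦ, hs s le_rfl, eq_bot_iff]
    rintro _ ⟨⟨z, hz⟩, hz0, rfl⟩
    obtain rfl : z = 0 := hz0
    exact map_zero (ψ i j)
  · rw [hΦ, ht t le_rfl, eq_top_iff]
    intro m _
    obtain ⟨z, rfl⟩ := hψ i j m
    exact ⟨z, z.2.1, rfl⟩
  refine ⟨max (p - s) (t - p + 1), fun r hr hR => ⟨?_, ?_, ?_⟩⟩
  · rintro ⟨p', i', j'⟩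
    refine K.page_d_eq_zero_of_subsingleton_right _ _ fun h => ?_
    simp only [Prod.mk_add_mk, Prod.mk.injEq] at h
    exact K.subsingleton_E_of_eq_bot (hs _ (by omega) _ _)
  · rintro ⟨p', i', j'⟩
    refine K.page_d_eq_zero_of_subsingleton_left _ _ fun h => ?_
    simp only [Prod.mk_add_mk, Prod.mk.injEq] at h
    refine K.subsingleton_E_of_eq ?_
    dsimp only
    rw [ht _ (by omega), ht _ (by omega)]
  · have hbot : K.F (p - r) (i + 1) j = ⊥ := hs _ (by omega) _ _
    have htop : K.F (p + r - 1) (i - 1) j = top (i - 1) j := ht _ (by omega) _ _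
    have hZ : K.Z r p i j ≤ top i j ⊓ LinearMap.ker K.δ := by
      intro z hz
      refine ⟨hFtop _ _ _ hz.1, ?_⟩
      have := hz.2
      rwa [hbot] at this
    let θ₀ : ↥(K.Z r p i j) →ₗ[𝕜] ↥(Φ i j p) :=
      ((ψ i j).comp (Submodule.inclusion hZ)).codRestrict _ fun z => by
        rw [hΦ]
        exact ⟨Submodule.inclusion hZ z, z.2.1, rfl⟩
    let θ : ↥(K.Z r p i j) →ₗ[𝕜] (↥(Φ i j p) ⧸ (Φ i j (p - 1)).submoduleOf (Φ i j p)) :=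
      (Submodule.mkQ _).comp θ₀
    have hθ : Function.Surjective θ := by
      refine (Submodule.mkQ_surjective _).comp ?_
      rintro ⟨m, hm⟩
      have hm' := hm
      rw [hΦ] at hm'
      obtain ⟨z, hz, rfl⟩ := hm'
      refine ⟨⟨z.1, hz, ?_⟩, Subtype.ext rfl⟩
      change K.δ z.1 ∈ K.F (p - r) (i + 1) j
      rw [show K.δ z.1 = 0 from z.2.2]
      exact zero_mem _
    have hkerθ : LinearMap.ker θ = (K.N r p i j).submoduleOf (K.Z r p i j) := by
      ext ⟨z, hz⟩
      rw [LinearMap.mem_ker]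
      refine (Submodule.Quotient.mk_eq_zero _).trans ?_
      change ψ i j ⟨z, hZ hz⟩ ∈ Φ i j (p - 1) ↔ z ∈ K.N r p i j
      rw [hΦ, mem_N]
      constructor
      · rintro ⟨⟨u, hu⟩, huF, hψu⟩
        have h0 : ψ i j (⟨z, hZ hz⟩ - ⟨u, hu⟩) = 0 := by rw [map_sub, hψu, sub_self]
        obtain ⟨b, hb, hδb⟩ := (hker i j _).1 h0
        have hδb' : K.δ b = z - u := hδb
        refine ⟨u, b, ⟨huF, ?_⟩, ⟨htop ▸ hb, ?_⟩, ?_⟩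
        · rw [show K.δ u = 0 from hu.2]
          exact zero_mem _
        · rw [hδb']
          exact sub_mem hz.1 (K.mono i j (by omega) huF)
        · rw [hδb', add_sub_cancel]
      · rintro ⟨u, b, hu, hb, huz⟩
        have hu0 : K.δ u = 0 := by
          have := hu.2
          rwa [hbot] at this
        refine ⟨⟨u, hFtop _ _ _ hu.1, hu0⟩, hu.1, ?_⟩
        rw [← sub_eq_zero, ← map_sub, hker]
        refine ⟨-b, neg_mem (htop ▸ hb.1), ?_⟩
        rw [map_neg]
        change - K.δ b = u - z
        rw [← huz, sub_add_cancel_left]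
    exact ⟨LinearEquiv.toModuleIso ((Submodule.quotEquivOfEq _ _ hkerθ.symm).trans
      (θ.quotKerEquivOfSurjective hθ))⟩

end FilteredComplex

namespace LinkDiagram

/-! ### The multipunctured filtration -/

section Filtration

variable {D : LinkDiagram} {𝕜 : Type u} [Field 𝕜]

theorem generatedBy_mono {A B : Set D.State} (h : A ⊆ B) :
    generatedBy 𝕜 A ≤ generatedBy 𝕜 B := fun _ hf x hx => h (hf x hx)

theorem d_apply_congr {f g : D.CKh 𝕜} {y : D.State}
    (h : ∀ x, dCoeff x y ≠ 0 → f x = g x) : D.d 𝕜 f y = D.d 𝕜 g y := by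
  rw [d_apply, d_apply]
  refine Finset.sum_congr rfl fun x _ => ?_
  by_cases hx : dCoeff x y = 0
  · simp [hx]
  · rw [h x hx]

theorem exists_of_d_apply_ne_zero {f : D.CKh 𝕜} {y : D.State} (h : D.d 𝕜 f y ≠ 0) :
    ∃ x, f x ≠ 0 ∧ dCoeff x y ≠ 0 := by
  by_contra! hx
  refine h ?_
  rw [d_apply]
  refine Finset.sum_eq_zero fun x _ => ?_
  by_cases hfx : f x = 0
  · simp [hfx]
  · simp [hx x hfx]

variable {ι : Type} {place : ι → D.Region}

theorem filtLT_eq (i j : ℤ) (v : ι → ℤ) : filtLT 𝕜 place i j v =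
    generatedBy 𝕜 {x : D.State | hDeg x = i ∧ qDeg x = j ∧ gDeg place x < v} := by
  classical
  refine le_antisymm (iSup₂_le fun b hb => generatedBy_mono fun x hx =>
    ⟨hx.1, hx.2.1, hx.2.2.trans_lt hb⟩) fun f hf => ?_
  rw [← Finset.univ_sum_single f]
  refine Submodule.sum_mem _ fun x _ => ?_
  by_cases hx : f x = 0
  · rw [hx, Pi.single_zero]
    exact zero_mem _
  · obtain ⟨h1, h2, h3⟩ := hf x hx
    refine Submodule.mem_iSup_of_mem _ (Submodule.mem_iSup_of_mem h3 fun y hy => ?_)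
    obtain rfl : y = x := by
      by_contra hne
      exact hy (Pi.single_eq_of_ne hne _)
    exact ⟨h1, h2, le_rfl⟩

theorem mem_filtLT {i j : ℤ} {v : ι → ℤ} {f : D.CKh 𝕜} : f ∈ filtLT 𝕜 place i j v ↔
    ∀ x, f x ≠ 0 → hDeg x = i ∧ qDeg x = j ∧ gDeg place x < v := by
  rw [filtLT_eq]
  rfl

theorem toH_eq_zero_iff {i j : ℤ} {v : ι → ℤ} (z : ↥(grCycles 𝕜 place i j v)) :
    toH 𝕜 place i j v z = 0 ↔ z.1 ∈ grBoundaries 𝕜 place i j v :=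
  Submodule.Quotient.mk_eq_zero _

theorem toH_eq_iff {i j : ℤ} {v : ι → ℤ} (z w : ↥(grCycles 𝕜 place i j v)) :
    toH 𝕜 place i j v z = toH 𝕜 place i j v w ↔ z.1 - w.1 ∈ grBoundaries 𝕜 place i j v :=
  Submodule.Quotient.eq _

variable (place)

open scoped Classical in
/-- The component of an element in a multipunctured degree. -/
def homogeneous (v : ι → ℤ) : D.CKh 𝕜 →ₗ[𝕜] D.CKh 𝕜 where
  toFun f x := if gDeg place x = v then f x else 0
  map_add' f g := by ext x; simp only [Pi.add_apply]; split_ifs <;> simp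
  map_smul' a f := by ext x; simp only [Pi.smul_apply]; split_ifs <;> simp

open scoped Classical in
theorem homogeneous_apply (v : ι → ℤ) (f : D.CKh 𝕜) (x : D.State) :
    homogeneous place v f x = if gDeg place x = v then f x else 0 := rfl

theorem homogeneous_apply_of_eq {v : ι → ℤ} (f : D.CKh 𝕜) {x : D.State} (h : gDeg place x = v) :
    homogeneous place v f x = f x := if_pos h

theorem homogeneous_apply_of_ne {v : ι → ℤ} (f : D.CKh 𝕜) {x : D.State} (h : gDeg place x ≠ v) :
    homogeneous place v f x = 0 := if_neg h

theorem homogeneous_apply_ne_zero {v : ι → ℤ} {f : D.CKh 𝕜} {x : D.State}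
    (h : homogeneous place v f x ≠ 0) : gDeg place x = v ∧ f x ≠ 0 := by
  by_cases hx : gDeg place x = v
  · rw [homogeneous_apply_of_eq place f hx] at h
    exact ⟨hx, h⟩
  · exact absurd (homogeneous_apply_of_ne place f hx) h

open scoped Classical in
/-- The part of the differential that preserves the multipunctured degree. -/
def gradedD : D.CKh 𝕜 →ₗ[𝕜] D.CKh 𝕜 where
  toFun f y := ∑ x, if gDeg place x = gDeg place y then (dCoeff x y : 𝕜) * f x else 0
  map_add' f g := by
    ext y
    simp only [Pi.add_apply, ← Finset.sum_add_distrib]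
    exact Finset.sum_congr rfl fun x _ => by split_ifs <;> ring
  map_smul' a f := by
    ext y
    simp only [Pi.smul_apply, smul_eq_mul, Finset.mul_sum, RingHom.id_apply]
    exact Finset.sum_congr rfl fun x _ => by split_ifs <;> ring

/-- The value of `gradedD` at `y` only involves coefficients in the degree of `y`. -/
theorem gradedD_apply (f : D.CKh 𝕜) (y : D.State) :
    gradedD place f y = D.d 𝕜 (homogeneous place (gDeg place y) f) y := by
  change (∑ x, _) = ∑ x, _
  refine Finset.sum_congr rfl fun x _ => ?_
  split_ifs with h
  · rw [homogeneous_apply_of_eq place f h]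
    rfl
  · rw [homogeneous_apply_of_ne place f h, mul_zero]

theorem exists_of_gradedD_apply_ne_zero {f : D.CKh 𝕜} {y : D.State} (h : gradedD place f y ≠ 0) :
    ∃ x, f x ≠ 0 ∧ dCoeff x y ≠ 0 ∧ gDeg place x = gDeg place y := by
  rw [gradedD_apply] at h
  obtain ⟨x, hx, hxy⟩ := exists_of_d_apply_ne_zero h
  obtain ⟨h1, h2⟩ := homogeneous_apply_ne_zero place hx
  exact ⟨x, h2, hxy, h1⟩

theorem gradedD_homogeneous (v : ι → ℤ) (f : D.CKh 𝕜) :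
    gradedD place (homogeneous place v f) = homogeneous place v (gradedD place f) := by
  ext y
  by_cases hy : gDeg place y = v
  · rw [homogeneous_apply_of_eq place _ hy, gradedD_apply, gradedD_apply]
    refine d_apply_congr fun x _ => ?_
    by_cases hx : gDeg place x = gDeg place y
    · rw [homogeneous_apply_of_eq place _ hx, homogeneous_apply_of_eq place _ hx,
        homogeneous_apply_of_eq place _ (hx.trans hy)]
    · rw [homogeneous_apply_of_ne place _ hx, homogeneous_apply_of_ne place _ hx]
  · rw [homogeneous_apply_of_ne place _ hy]
    by_contra h
    obtain ⟨x, hx, -, hxy⟩ := exists_of_gradedD_apply_ne_zero place h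
    exact hy (hxy.symm.trans (homogeneous_apply_ne_zero place hx).1)

/-- Since the differential does not increase the degree, the part that preserves it is a
differential. -/
theorem gradedD_gradedD (f : D.CKh 𝕜) : gradedD place (gradedD place f) = 0 := by
  ext y
  rw [gradedD_apply, ← gradedD_homogeneous, Pi.zero_apply,
    ← Pi.zero_apply (M := fun _ : D.State => 𝕜) y,
    ← d_d 𝕜 (homogeneous place (gDeg place y) f), ← sub_eq_zero, ← Pi.sub_apply, ← map_sub]
  by_contra h
  obtain ⟨z, hz, hzy⟩ := exists_of_d_apply_ne_zero h
  have h1 := gDeg_le_of_dCoeff_ne_zero place hzy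
  rw [Pi.sub_apply, gradedD_apply] at hz
  refine hz (sub_eq_zero.2 (d_apply_congr fun x hxz => ?_))
  have h2 := gDeg_le_of_dCoeff_ne_zero place hxz
  by_cases hx : gDeg place x = gDeg place y
  · rw [homogeneous_apply_of_eq place _ (le_antisymm ?_ h2)]
    rwa [hx]
  · rw [homogeneous_apply_of_ne place _ hx, homogeneous_apply]
    split_ifs
    · exact homogeneous_apply_of_ne place f hx
    · rfl

variable {place}

section Compare

variable {ι' : Type} {place' : ι' → D.Region}

/-- On a step of the filtration by `place`, the differential and its part that preserves the degree
for `place'` agree up to the smaller steps, if the degree for `place` determines the one for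
`place'`. -/
theorem d_sub_gradedD_mem
    (hg : ∀ x y, gDeg place x = gDeg place y → gDeg place' x = gDeg place' y)
    {i j : ℤ} {v : ι → ℤ} {f : D.CKh 𝕜} (hf : f ∈ filt 𝕜 place i j v) :
    D.d 𝕜 f - gradedD place' f ∈ filtLT 𝕜 place (i + 1) j v := by
  rw [mem_filtLT]
  intro y hy
  have hex : ∃ x, f x ≠ 0 ∧ dCoeff x y ≠ 0 := by
    by_contra! hx
    have h1 : D.d 𝕜 f y = 0 := by
      by_contra h
      obtain ⟨x, hfx, hxy⟩ := exists_of_d_apply_ne_zero h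
      exact hxy (hx x hfx)
    have h2 : gradedD place' f y = 0 := by
      by_contra h
      obtain ⟨x, hfx, hxy, -⟩ := exists_of_gradedD_apply_ne_zero place' h
      exact hxy (hx x hfx)
    exact hy (by rw [Pi.sub_apply, h1, h2, sub_zero])
  obtain ⟨x, hfx, hxy⟩ := hex
  obtain ⟨h1, h2, h3⟩ := hf x hfx
  refine ⟨by rw [hDeg_of_dCoeff_ne_zero hxy, h1], by rw [qDeg_of_dCoeff_ne_zero hxy, h2],
    ((gDeg_le_of_dCoeff_ne_zero place hxy).trans h3).lt_of_ne fun hyv => hy ?_⟩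
  rw [Pi.sub_apply, gradedD_apply, sub_eq_zero]
  refine d_apply_congr fun z hzy => ?_
  by_cases hfz : f z = 0
  · rw [hfz, homogeneous_apply, hfz, ite_self]
  · have hzv : gDeg place z = gDeg place y :=
      le_antisymm (hyv ▸ (hf z hfz).2.2) (gDeg_le_of_dCoeff_ne_zero place hzy)
    rw [homogeneous_apply_of_eq place' f (hg _ _ hzv)]

end Compare

end Filtration

end LinkDiagram

namespace LinkDiagram

/-! ### The limit of the spectral sequence -/

section Convergence

variable {D : LinkDiagram} {𝕜 : Type u} [Field 𝕜] {ι : Type} {place : ι → D.Region}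

variable (D 𝕜) in
/-- The part of the Khovanov complex of homological degree `i` and quantum degree `j`. -/
def bidegree (i j : ℤ) : Submodule 𝕜 (D.CKh 𝕜) := generatedBy 𝕜 {x | hDeg x = i ∧ qDeg x = j}

theorem filt_le_bidegree (i j : ℤ) (v : ι → ℤ) : filt 𝕜 place i j v ≤ D.bidegree 𝕜 i j :=
  generatedBy_mono fun _ hx => ⟨hx.1, hx.2.1⟩

theorem homogeneous_mem_filt {i j : ℤ} (v : ι → ℤ) {f : D.CKh 𝕜} (hf : f ∈ D.bidegree 𝕜 i j) :
    homogeneous place v f ∈ filt 𝕜 place i j v := by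
  intro x hx
  obtain ⟨h1, h2⟩ := homogeneous_apply_ne_zero place hx
  exact ⟨(hf x h2).1, (hf x h2).2, h1.le⟩

theorem sub_homogeneous_mem_filtLT {i j : ℤ} {v : ι → ℤ} {f : D.CKh 𝕜}
    (hf : f ∈ filt 𝕜 place i j v) : f - homogeneous place v f ∈ filtLT 𝕜 place i j v := by
  rw [mem_filtLT]
  intro x hx
  rw [Pi.sub_apply] at hx
  by_cases hxv : gDeg place x = v
  · rw [homogeneous_apply_of_eq place f hxv, sub_self] at hx
    exact absurd rfl hx
  · rw [homogeneous_apply_of_ne place f hxv, sub_zero] at hx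
    obtain ⟨h1, h2, h3⟩ := hf x hx
    exact ⟨h1, h2, h3.lt_of_ne hxv⟩

theorem homogeneous_eq_zero_of_mem_filtLT {i j : ℤ} {v : ι → ℤ} {f : D.CKh 𝕜}
    (hf : f ∈ filtLT 𝕜 place i j v) : homogeneous place v f = 0 := by
  ext x
  by_contra hx
  obtain ⟨h1, h2⟩ := homogeneous_apply_ne_zero place hx
  exact (mem_filtLT.1 hf x h2).2.2.ne h1

theorem homogeneous_homogeneous (v : ι → ℤ) (f : D.CKh 𝕜) :
    homogeneous place v (homogeneous place v f) = homogeneous place v f := by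
  ext x
  by_cases hxv : gDeg place x = v
  · rw [homogeneous_apply_of_eq place _ hxv]
  · rw [homogeneous_apply_of_ne place _ hxv, homogeneous_apply_of_ne place _ hxv]

open scoped Classical in
theorem sum_homogeneous (f : D.CKh 𝕜) :
    ∑ v ∈ Finset.univ.image (gDeg place), homogeneous place v f = f := by
  ext x
  rw [Finset.sum_apply, Finset.sum_eq_single (gDeg place x)]
  · exact homogeneous_apply_of_eq place f rfl
  · exact fun v _ hv => homogeneous_apply_of_ne place f hv.symm
  · simp

open scoped Classical in
theorem homogeneous_eq_zero_of_notMem {v : ι → ℤ} (hv : v ∉ Finset.univ.image (gDeg place))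
    (f : D.CKh 𝕜) : homogeneous place v f = 0 := by
  ext x
  exact homogeneous_apply_of_ne place f fun h => hv (by simp [← h])

theorem d_homogeneous_eq {i j : ℤ} (v : ι → ℤ) {f : D.CKh 𝕜} (hf : f ∈ D.bidegree 𝕜 i j) :
    D.d 𝕜 (homogeneous place v f) - homogeneous place v (gradedD place f) ∈
      filtLT 𝕜 place (i + 1) j v := by
  rw [← gradedD_homogeneous]
  exact d_sub_gradedD_mem (fun _ _ h => h) (homogeneous_mem_filt v hf)

/-- The homogeneous components of cycles for `gradedD` are cycles of the associated graded
complex. -/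
theorem homogeneous_mem_grCycles {i j : ℤ} (v : ι → ℤ) {f : D.CKh 𝕜}
    (hf : f ∈ D.bidegree 𝕜 i j ⊓ LinearMap.ker (gradedD place)) :
    homogeneous place v f ∈ grCycles 𝕜 place i j v := by
  refine ⟨homogeneous_mem_filt v hf.1, ?_⟩
  change D.d 𝕜 (homogeneous place v f) ∈ filtLT 𝕜 place (i + 1) j v
  have := d_homogeneous_eq (place := place) v hf.1
  rwa [show gradedD place f = 0 from hf.2, map_zero, sub_zero] at this

/-- The homogeneous component of a cycle of the associated graded complex is a cycle for
`gradedD`. -/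
theorem gradedD_homogeneous_of_mem_grCycles {i j : ℤ} {v : ι → ℤ} {f : D.CKh 𝕜}
    (hf : f ∈ grCycles 𝕜 place i j v) : gradedD place (homogeneous place v f) = 0 := by
  have h1 := d_sub_gradedD_mem (place' := place) (fun _ _ h => h) hf.1
  have h2 := sub_mem (show D.d 𝕜 f ∈ filtLT 𝕜 place (i + 1) j v from hf.2) h1
  rw [sub_sub_cancel] at h2
  rw [gradedD_homogeneous, homogeneous_eq_zero_of_mem_filtLT h2]

/-- Boundaries of the associated graded complex are the boundaries for `gradedD`, up to smaller
steps of the filtration. -/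
theorem exists_of_mem_grBoundaries {i j : ℤ} {v : ι → ℤ} {f : D.CKh 𝕜}
    (hf : f ∈ grBoundaries 𝕜 place i j v) : ∃ b ∈ filt 𝕜 place (i - 1) j v,
      homogeneous place v f = gradedD place (homogeneous place v b) := by
  obtain ⟨a, ha, _, ⟨b, hb, rfl⟩, rfl⟩ := Submodule.mem_sup.1 hf
  refine ⟨b, hb, ?_⟩
  have h1 := d_sub_gradedD_mem (place' := place) (fun _ _ h => h) hb
  rw [map_add, homogeneous_eq_zero_of_mem_filtLT ha, zero_add, gradedD_homogeneous,
    ← sub_eq_zero, ← map_sub, homogeneous_eq_zero_of_mem_filtLT h1]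

theorem homogeneous_gradedD_mem_grBoundaries {i j : ℤ} (v : ι → ℤ) {b : D.CKh 𝕜}
    (hb : b ∈ D.bidegree 𝕜 (i - 1) j) :
    homogeneous place v (gradedD place b) ∈ grBoundaries 𝕜 place i j v := by
  have h1 := d_homogeneous_eq (place := place) v hb
  rw [sub_add_cancel] at h1
  refine Submodule.mem_sup.2 ⟨_, neg_mem h1, _, ⟨_, homogeneous_mem_filt v hb, rfl⟩, ?_⟩
  abel

variable (place) in
/-- The class of the component in degree `v` of a cycle for `gradedD`. -/
def componentClass (i j : ℤ) (v : ι → ℤ) :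
    ↥(D.bidegree 𝕜 i j ⊓ LinearMap.ker (gradedD place)) →ₗ[𝕜] H 𝕜 place i j v :=
  (toH 𝕜 place i j v).comp
    (((homogeneous place v).comp (Submodule.subtype _)).codRestrict _ fun z =>
      homogeneous_mem_grCycles v z.2)

theorem componentClass_apply {i j : ℤ} {v : ι → ℤ}
    (z : ↥(D.bidegree 𝕜 i j ⊓ LinearMap.ker (gradedD place))) :
    componentClass place i j v z =
      toH 𝕜 place i j v ⟨homogeneous place v z.1, homogeneous_mem_grCycles v z.2⟩ := rfl

variable (place) in
open scoped Classical in
/-- The class of a cycle for `gradedD` in the homology of the associated graded complex. -/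
def totalClass (i j : ℤ) :
    ↥(D.bidegree 𝕜 i j ⊓ LinearMap.ker (gradedD place)) →ₗ[𝕜] totalH 𝕜 place i j :=
  ∑ v ∈ Finset.univ.image (gDeg place),
    (DirectSum.lof 𝕜 (ι → ℤ) (fun v => H 𝕜 place i j v) v).comp (componentClass place i j v)

theorem component_totalClass {i j : ℤ} (v : ι → ℤ)
    (z : ↥(D.bidegree 𝕜 i j ⊓ LinearMap.ker (gradedD place))) :
    DirectSum.component 𝕜 (ι → ℤ) (fun v => H 𝕜 place i j v) v (totalClass place i j z) =
      componentClass place i j v z := by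
  classical
  rw [totalClass, LinearMap.sum_apply, map_sum]
  by_cases hv : v ∈ Finset.univ.image (gDeg place)
  · rw [Finset.sum_eq_single_of_mem v hv]
    · exact DirectSum.component.lof_self 𝕜 v _
    · intro w _ hw
      exact (DirectSum.component.of 𝕜 v w _).trans (dif_neg hw)
  · rw [Finset.sum_eq_zero]
    · symm
      rw [componentClass_apply, toH_eq_zero_iff]
      change homogeneous place v z.1 ∈ _
      rw [homogeneous_eq_zero_of_notMem hv]
      exact zero_mem _
    · intro w hw
      exact (DirectSum.component.of 𝕜 v w _).trans (dif_neg fun h : w = v => hv (h ▸ hw))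

theorem totalClass_eq_zero_iff {i j : ℤ}
    (z : ↥(D.bidegree 𝕜 i j ⊓ LinearMap.ker (gradedD place))) :
    totalClass place i j z = 0 ↔ ∃ b ∈ D.bidegree 𝕜 (i - 1) j, gradedD place b = z.1 := by
  classical
  have h0 : totalClass place i j z = 0 ↔
      ∀ v, homogeneous place v z.1 ∈ grBoundaries 𝕜 place i j v := by
    rw [DirectSum.ext_component_iff 𝕜]
    refine forall_congr' fun v => ?_
    rw [component_totalClass, map_zero, componentClass_apply, toH_eq_zero_iff]
  rw [h0]
  constructor
  · intro h
    choose b hb hzb using fun v => exists_of_mem_grBoundaries (h v)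
    refine ⟨∑ v ∈ Finset.univ.image (gDeg place), homogeneous place v (b v),
      Submodule.sum_mem _ fun v _ => filt_le_bidegree _ _ v
        (homogeneous_mem_filt v (filt_le_bidegree _ _ v (hb v))), ?_⟩
    rw [map_sum]
    refine Eq.trans ?_ (sum_homogeneous (place := place) z.1)
    exact Finset.sum_congr rfl fun v _ => by rw [← hzb v, homogeneous_homogeneous]
  · rintro ⟨b, hb, hbz⟩ v
    rw [← hbz]
    exact homogeneous_gradedD_mem_grBoundaries v hb

variable {ι' : Type} [Fintype ι] [Fintype ι'] {place' : ι' → D.Region}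

/-- The induced filtration consists of the classes of the cycles in the steps of the flattened
filtration. -/
theorem inducedFilt_eq_map (i j p : ℤ) : inducedFilt 𝕜 place place' i j p =
    ((flatFilt 𝕜 place p).submoduleOf (D.bidegree 𝕜 i j ⊓ LinearMap.ker (gradedD place'))).map
      (totalClass place' i j) := by
  classical
  have hhom : ∀ (w : ι' → ℤ) (f : D.CKh 𝕜), f ∈ flatFilt 𝕜 place p →
      homogeneous place' w f ∈ flatFilt 𝕜 place p := fun w f hf x hx =>
    hf x (homogeneous_apply_ne_zero place' hx).2
  ext m
  simp only [inducedFilt, Submodule.mem_iInf, Submodule.mem_comap]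
  constructor
  · intro hm
    choose f hf hfm using hm
    let g : D.CKh 𝕜 := ∑ w ∈ Finset.univ.image (gDeg place'), homogeneous place' w (f w).1
    have hg : g ∈ D.bidegree 𝕜 i j ⊓ LinearMap.ker (gradedD place') := by
      refine Submodule.sum_mem _ fun w _ => ⟨filt_le_bidegree _ _ w
        (homogeneous_mem_filt w (filt_le_bidegree _ _ w (f w).2.1)), ?_⟩
      exact gradedD_homogeneous_of_mem_grCycles (f w).2
    have hgw : ∀ w, homogeneous place' w g = homogeneous place' w (f w).1 := by
      intro w
      ext x
      by_cases hx : gDeg place' x = w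
      · rw [homogeneous_apply_of_eq place' _ hx]
        refine (Finset.sum_apply _ _ _).trans ?_
        rw [Finset.sum_eq_single w]
        · exact fun w' _ hw' => homogeneous_apply_of_ne place' _ fun h => hw' (h.symm.trans hx)
        · exact fun hw => absurd (Finset.mem_image.2 ⟨x, Finset.mem_univ _, hx⟩) hw
      · rw [homogeneous_apply_of_ne place' _ hx, homogeneous_apply_of_ne place' _ hx]
    refine ⟨⟨g, hg⟩, Submodule.sum_mem _ fun w _ => hhom w _ (hf w), ?_⟩
    refine (DirectSum.ext_component_iff 𝕜).2 fun w => ?_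
    rw [component_totalClass, ← hfm, componentClass_apply, toH_eq_iff]
    refine Submodule.mem_sup_left ?_
    change homogeneous place' w g - (f w).1 ∈ _
    rw [hgw, ← neg_sub]
    exact neg_mem (sub_homogeneous_mem_filtLT (f w).2.1)
  · rintro ⟨z, hz, rfl⟩ w
    rw [component_totalClass, componentClass_apply]
    exact ⟨_, hhom w _ hz, rfl⟩

variable (place place') in
/-- The associated graded complex of the Khovanov complex for the punctures `place'`, filtered by
the flattened degree for the punctures `place`. -/
def filteredComplex : FilteredComplex 𝕜 (D.CKh 𝕜) where
  δ := gradedD place'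
  δ_δ := gradedD_gradedD place'
  F p i j := generatedBy 𝕜 {x | hDeg x = i ∧ qDeg x = j ∧ ∑ a, gDeg place x a ≤ p}
  mono _ _ _ _ hpq := generatedBy_mono fun _ hx => ⟨hx.1, hx.2.1, hx.2.2.trans hpq⟩
  map_mem p i j f hf y hy := by
    obtain ⟨x, hfx, hxy, -⟩ := exists_of_gradedD_apply_ne_zero place' hy
    obtain ⟨h1, h2, h3⟩ := hf x hfx
    exact ⟨by rw [hDeg_of_dCoeff_ne_zero hxy, h1], by rw [qDeg_of_dCoeff_ne_zero hxy, h2],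
      (Finset.sum_le_sum fun a _ => gDeg_le_of_dCoeff_ne_zero place hxy a).trans h3⟩

theorem filteredComplex_convergesTo :
    (filteredComplex (𝕜 := 𝕜) place place').spectralSequence.ConvergesTo
      (fun i j => totalH 𝕜 place' i j) (inducedFilt 𝕜 place place') := by
  classical
  obtain ⟨B, hB⟩ : ∃ B : ℤ, ∀ x : D.State, |∑ a, gDeg place x a| ≤ B :=
    ⟨∑ x : D.State, |∑ a, gDeg place x a|, fun x =>
      Finset.single_le_sum (f := fun x : D.State => |∑ a, gDeg place x a|)
        (fun _ _ => abs_nonneg _) (Finset.mem_univ x)⟩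
  have hlow : ∀ x : D.State, -B ≤ ∑ a, gDeg place x a := fun x => (abs_le.1 (hB x)).1
  have hhigh : ∀ x : D.State, ∑ a, gDeg place x a ≤ B := fun x => (abs_le.1 (hB x)).2
  refine FilteredComplex.convergesTo _ (D.bidegree 𝕜) (s := -B - 1) (t := B) ?_ ?_ _ _
    (totalClass place') ?_ (fun i j z => totalClass_eq_zero_iff z) ?_
  · intro p hp i j
    refine (Submodule.eq_bot_iff _).2 fun f hf => ?_
    ext x
    by_contra hx
    have h1 := (hf x hx).2.2
    have h2 := hlow x
    omega
  · intro p hp i j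
    refine le_antisymm (generatedBy_mono fun x hx => ⟨hx.1, hx.2.1⟩)
      (generatedBy_mono fun x hx => ⟨hx.1, hx.2, (hhigh x).trans hp⟩)
  · intro i j m
    have hm : m ∈ inducedFilt 𝕜 place place' i j B := by
      refine (Submodule.mem_iInf _).2 fun w => ?_
      obtain ⟨f, hf⟩ := Submodule.mkQ_surjective _
        (DirectSum.component 𝕜 (ι' → ℤ) (fun w => H 𝕜 place' i j w) w m)
      exact ⟨f, fun x _ => hhigh x, hf⟩
    rw [inducedFilt_eq_map] at hm
    obtain ⟨z, -, hz⟩ := hm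
    exact ⟨z, hz⟩
  · intro i j p
    rw [inducedFilt_eq_map]
    congr 1
    ext z
    exact ⟨fun hz x hx => ⟨(z.2.1 x hx).1, (z.2.1 x hx).2, hz x hx⟩, fun hz x hx => (hz x hx).2.2⟩

end Convergence

/-! ### The first page of the spectral sequence -/

section FirstPage

variable {D : LinkDiagram} {𝕜 : Type u} [Field 𝕜] {ι ι' : Type} [Fintype ι]
  {place : ι → D.Region} {place' : ι' → D.Region}

theorem eq_of_le_of_sum_eq {v w : ι → ℤ} (h : v ≤ w) (hs : ∑ a, w a ≤ ∑ a, v a) : v = w := by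
  funext a
  exact (Finset.sum_eq_sum_iff_of_le fun a _ => h a).1
    (le_antisymm (Finset.sum_le_sum fun a _ => h a) hs) a (Finset.mem_univ a)

theorem sum_gDeg_lt {x : D.State} {v : ι → ℤ} (h : gDeg place x < v) :
    ∑ a, gDeg place x a < ∑ a, v a := by
  by_contra! hs
  exact h.ne (eq_of_le_of_sum_eq h.le hs)

theorem filt_le_F [Fintype ι'] (i j : ℤ) (v : ι → ℤ) :
    filt 𝕜 place i j v ≤ (filteredComplex (𝕜 := 𝕜) place place').F (∑ a, v a) i j :=
  generatedBy_mono fun _ hx => ⟨hx.1, hx.2.1, Finset.sum_le_sum fun a _ => hx.2.2 a⟩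

theorem filtLT_le_F [Fintype ι'] (i j : ℤ) (v : ι → ℤ) :
    filtLT 𝕜 place i j v ≤ (filteredComplex (𝕜 := 𝕜) place place').F (∑ a, v a - 1) i j := by
  rw [filtLT_eq]
  exact generatedBy_mono fun _ hx => ⟨hx.1, hx.2.1, Int.le_sub_one_of_lt (sum_gDeg_lt hx.2.2)⟩

theorem grCycles_le_Z [Fintype ι']
    (hg : ∀ x y : D.State, gDeg place x = gDeg place y → gDeg place' x = gDeg place' y)
    {p i j : ℤ} {v : ι → ℤ} (hv : ∑ a, v a = p) :
    grCycles 𝕜 place i j v ≤ (filteredComplex (𝕜 := 𝕜) place place').Z 1 p i j := by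
  subst hv
  intro f hf
  refine ⟨filt_le_F (place' := place') i j v hf.1, ?_⟩
  have := sub_mem (show D.d 𝕜 f ∈ filtLT 𝕜 place (i + 1) j v from hf.2)
    (d_sub_gradedD_mem (place' := place') hg hf.1)
  rw [sub_sub_cancel] at this
  exact filtLT_le_F (place' := place') _ _ _ this

theorem mem_N_of_mem_grBoundaries [Fintype ι']
    (hg : ∀ x y : D.State, gDeg place x = gDeg place y → gDeg place' x = gDeg place' y)
    {p i j : ℤ} {v : ι → ℤ} (hv : ∑ a, v a = p) {f : D.CKh 𝕜}
    (hf : f ∈ grBoundaries 𝕜 place i j v)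
    (hfZ : f ∈ (filteredComplex (𝕜 := 𝕜) place place').Z 1 p i j) :
    f ∈ (filteredComplex (𝕜 := 𝕜) place place').N 1 p i j := by
  subst hv
  obtain ⟨a, ha, _, ⟨b, hb, rfl⟩, rfl⟩ := Submodule.mem_sup.1 hf
  have hb' := d_sub_gradedD_mem (place' := place') hg hb
  rw [sub_add_cancel] at hb'
  have hbF := filt_le_F (place' := place') _ _ _ hb
  have hδb := (filteredComplex (𝕜 := 𝕜) place place').map_mem _ _ _ _ hbF
  rw [sub_add_cancel] at hδb
  refine FilteredComplex.mem_N.2 ⟨a + (D.d 𝕜 b - gradedD place' b), b,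
    ⟨filtLT_le_F (place' := place') _ _ _ (add_mem ha hb'), ?_⟩, ⟨?_, hδb⟩, ?_⟩
  · have h1 : gradedD place' (a + (D.d 𝕜 b - gradedD place' b)) =
        gradedD place' (a + D.d 𝕜 b) := by
      rw [← add_sub_assoc, map_sub, gradedD_gradedD, sub_zero]
    change gradedD place' _ ∈ _
    rw [h1]
    exact hfZ.2
  · rw [add_sub_cancel_right]
    exact hbF
  · change a + (D.d 𝕜 b - gradedD place' b) + gradedD place' b = _
    abel

/-- An element of the step `p` of the flattened filtration only has components of degree `v` or
not above `v`, if the components of `v` add up to `p`; so taking the component of degree `v` is a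
map of complexes up to the smaller steps. -/
theorem d_homogeneous_sub_mem [Fintype ι']
    (hg : ∀ x y : D.State, gDeg place x = gDeg place y → gDeg place' x = gDeg place' y)
    {i j : ℤ} {v : ι → ℤ} {f : D.CKh 𝕜}
    (hf : f ∈ (filteredComplex (𝕜 := 𝕜) place place').F (∑ a, v a) i j) :
    D.d 𝕜 (homogeneous place v f) - homogeneous place v (gradedD place' f) ∈
      filtLT 𝕜 place (i + 1) j v := by
  have hf' : f ∈ D.bidegree 𝕜 i j := fun x hx => ⟨(hf x hx).1, (hf x hx).2.1⟩
  have h1 := d_homogeneous_eq (place := place) v hf'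
  have h2 : homogeneous place v (gradedD place f) = homogeneous place v (gradedD place' f) := by
    ext y
    by_cases hy : gDeg place y = v
    · rw [homogeneous_apply_of_eq place _ hy, homogeneous_apply_of_eq place _ hy, gradedD_apply,
        gradedD_apply]
      refine d_apply_congr fun x hxy => ?_
      by_cases hfx : f x = 0
      · simp [homogeneous_apply, hfx]
      · have hle := gDeg_le_of_dCoeff_ne_zero place hxy
        have hxy' : gDeg place x = gDeg place y :=
          (eq_of_le_of_sum_eq hle (by rw [hy]; exact (hf x hfx).2.2)).symm
        rw [homogeneous_apply_of_eq place _ hxy', homogeneous_apply_of_eq place' _ (hg _ _ hxy')]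
    · rw [homogeneous_apply_of_ne place _ hy, homogeneous_apply_of_ne place _ hy]
  rwa [h2] at h1

theorem homogeneous_eq_zero_of_mem_F [Fintype ι'] {p i j : ℤ} {v : ι → ℤ} (hv : ∑ a, v a = p)
    {f : D.CKh 𝕜} (hf : f ∈ (filteredComplex (𝕜 := 𝕜) place place').F (p - 1) i j) :
    homogeneous place v f = 0 := by
  ext x
  by_contra hx
  obtain ⟨h1, h2⟩ := homogeneous_apply_ne_zero place hx
  have := (hf x h2).2.2
  rw [h1, hv] at this
  omega

theorem F_le_bidegree [Fintype ι'] (p i j : ℤ) :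
    (filteredComplex (𝕜 := 𝕜) place place').F p i j ≤ D.bidegree 𝕜 i j :=
  generatedBy_mono fun _ hx => ⟨hx.1, hx.2.1⟩

theorem homogeneous_mem_grCycles_of_mem_Z [Fintype ι']
    (hg : ∀ x y : D.State, gDeg place x = gDeg place y → gDeg place' x = gDeg place' y)
    {p i j : ℤ} {v : ι → ℤ} (hv : ∑ a, v a = p) {f : D.CKh 𝕜}
    (hf : f ∈ (filteredComplex (𝕜 := 𝕜) place place').Z 1 p i j) :
    homogeneous place v f ∈ grCycles 𝕜 place i j v := by
  refine ⟨homogeneous_mem_filt v (F_le_bidegree (place' := place') _ _ _ hf.1), ?_⟩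
  have h0 : homogeneous place v (gradedD place' f) = 0 :=
    homogeneous_eq_zero_of_mem_F (place' := place') hv hf.2
  have := d_homogeneous_sub_mem hg (hv ▸ hf.1)
  rwa [h0, sub_zero] at this

theorem homogeneous_mem_grBoundaries_of_mem_N [Fintype ι']
    (hg : ∀ x y : D.State, gDeg place x = gDeg place y → gDeg place' x = gDeg place' y)
    {p i j : ℤ} {v : ι → ℤ} (hv : ∑ a, v a = p) {f : D.CKh 𝕜}
    (hf : f ∈ (filteredComplex (𝕜 := 𝕜) place place').N 1 p i j) :
    homogeneous place v f ∈ grBoundaries 𝕜 place i j v := by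
  obtain ⟨u, b, hu, hb, rfl⟩ := FilteredComplex.mem_N.1 hf
  have hbF := hb.1
  rw [add_sub_cancel_right, ← hv] at hbF
  have h1 := d_homogeneous_sub_mem hg hbF
  rw [sub_add_cancel] at h1
  rw [map_add, homogeneous_eq_zero_of_mem_F (place' := place') hv hu.1, zero_add]
  refine Submodule.mem_sup.2 ⟨_, neg_mem h1, _,
    ⟨_, homogeneous_mem_filt v (F_le_bidegree (place' := place') _ _ _ hbF), rfl⟩, ?_⟩
  change -(_ - homogeneous place v (gradedD place' b)) + _ = homogeneous place v (gradedD place' b)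
  abel

section Maps

variable [Fintype ι']
  (hg : ∀ x y : D.State, gDeg place x = gDeg place y → gDeg place' x = gDeg place' y)
  {p : ℤ} (i j : ℤ) {v : ι → ℤ} (hv : ∑ a, v a = p)

/-- The map from the homology in degree `v` to the first page induced by the inclusion. -/
def toFirstPage : H 𝕜 place i j v →ₗ[𝕜] (filteredComplex (𝕜 := 𝕜) place place').E 1 p i j :=
  Submodule.mapQ _ _ (Submodule.inclusion (grCycles_le_Z hg hv)) fun f hf =>
    mem_N_of_mem_grBoundaries hg hv hf (grCycles_le_Z hg hv f.2)

/-- The map from the first page to the homology in degree `v` induced by taking the component of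
degree `v`. -/
def ofFirstPage : (filteredComplex (𝕜 := 𝕜) place place').E 1 p i j →ₗ[𝕜] H 𝕜 place i j v :=
  Submodule.mapQ _ _ (((homogeneous place v).comp (Submodule.subtype _)).codRestrict _ fun z =>
      homogeneous_mem_grCycles_of_mem_Z hg hv z.2)
    fun _ hz => homogeneous_mem_grBoundaries_of_mem_N hg hv hz

variable {i j}

theorem ofFirstPage_mk {z : D.CKh 𝕜}
    (hz : z ∈ (filteredComplex (𝕜 := 𝕜) place place').Z 1 p i j) :
    ofFirstPage hg i j hv (Submodule.Quotient.mk ⟨z, hz⟩) =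
      toH 𝕜 place i j v ⟨homogeneous place v z, homogeneous_mem_grCycles_of_mem_Z hg hv hz⟩ := rfl

theorem ofFirstPage_toFirstPage (m : H 𝕜 place i j v) :
    ofFirstPage hg i j hv (toFirstPage hg i j hv m) = m := by
  obtain ⟨z, rfl⟩ := Submodule.mkQ_surjective _ m
  refine Eq.trans (ofFirstPage_mk hg hv _) ((toH_eq_iff _ _).2 (Submodule.mem_sup_left ?_))
  rw [← neg_sub]
  exact neg_mem (sub_homogeneous_mem_filtLT z.2.1)

theorem ofFirstPage_toFirstPage_of_ne {w : ι → ℤ} (hw : ∑ a, w a = p) (hvw : v ≠ w)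
    (m : H 𝕜 place i j w) : ofFirstPage hg i j hv (toFirstPage hg i j hw m) = 0 := by
  obtain ⟨z, rfl⟩ := Submodule.mkQ_surjective _ m
  refine Eq.trans (ofFirstPage_mk hg hv _) ((toH_eq_zero_iff _).2 ?_)
  have : homogeneous place v z.1 = 0 := by
    ext x
    by_contra hx
    obtain ⟨h1, h2⟩ := homogeneous_apply_ne_zero place hx
    have h3 := (z.2.1 x h2).2.2
    rw [h1] at h3
    exact hvw (eq_of_le_of_sum_eq h3 (by rw [hv, hw]))
  change homogeneous place v z.1 ∈ _
  rw [this]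
  exact zero_mem _

end Maps

/-- A module is the direct sum of the modules `M v` if it has inclusions `α v` and projections
`β v` with the usual relations. -/
theorem nonempty_equiv_directSum {R E κ : Type*} {M : κ → Type*} [Ring R] [AddCommGroup E]
    [Module R E] [∀ v, AddCommGroup (M v)] [∀ v, Module R (M v)] (α : ∀ v, M v →ₗ[R] E)
    (β : ∀ v, E →ₗ[R] M v) (h1 : ∀ v m, β v (α v m) = m)
    (h2 : ∀ v w, v ≠ w → ∀ m, β v (α w m) = 0)
    (h3 : ∀ e, ∃ W : Finset κ, ∑ v ∈ W, α v (β v e) = e) :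
    Nonempty (E ≃ₗ[R] DirectSum κ M) := by
  classical
  have hcomp : ∀ v, (β v).comp (DirectSum.toModule R κ E α) = DirectSum.component R κ M v := by
    intro v
    refine DirectSum.linearMap_ext R fun w => LinearMap.ext fun m => ?_
    rw [LinearMap.comp_apply, LinearMap.comp_apply, LinearMap.comp_apply, DirectSum.toModule_lof]
    by_cases hvw : w = v
    · subst hvw
      rw [h1, DirectSum.component.lof_self]
    · rw [h2 v w (Ne.symm hvw)]
      exact ((DirectSum.component.of R v w m).trans (dif_neg hvw)).symm
  refine ⟨(LinearEquiv.ofBijective (DirectSum.toModule R κ E α) ⟨?_, fun e => ?_⟩).symm⟩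
  · rw [← LinearMap.ker_eq_bot, LinearMap.ker_eq_bot']
    intro m hm
    refine (DirectSum.ext_component_iff R).2 fun v => ?_
    rw [← hcomp, LinearMap.comp_apply, hm, map_zero, map_zero]
  · obtain ⟨W, hW⟩ := h3 e
    refine ⟨∑ v ∈ W, DirectSum.lof R κ M v (β v e), ?_⟩
    rw [map_sum, ← hW]
    simp only [DirectSum.toModule_lof, hW]

/-- The first page is the multipunctured homology with flattened grading. -/
theorem nonempty_firstPage_equiv [Fintype ι']
    (hg : ∀ x y : D.State, gDeg place x = gDeg place y → gDeg place' x = gDeg place' y)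
    (p i j : ℤ) : Nonempty ((filteredComplex (𝕜 := 𝕜) place place').E 1 p i j ≃ₗ[𝕜]
      flatH 𝕜 place i j p) := by
  classical
  refine nonempty_equiv_directSum (κ := {v : ι → ℤ // ∑ a, v a = p})
    (fun v => toFirstPage hg i j v.2) (fun v => ofFirstPage hg i j v.2)
    (fun v m => ofFirstPage_toFirstPage hg v.2 m)
    (fun v w hvw m => ofFirstPage_toFirstPage_of_ne hg v.2 w.2
      (fun h => hvw (Subtype.ext h)) m) fun e => ?_
  obtain ⟨⟨z, hz⟩, rfl⟩ := Submodule.Quotient.mk_surjective _ e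
  let W : Finset {v : ι → ℤ // ∑ a, v a = p} := (Finset.univ.image (gDeg place)).subtype _
  let c : {v : ι → ℤ // ∑ a, v a = p} → ↥((filteredComplex (𝕜 := 𝕜) place place').Z 1 p i j) :=
    fun v => ⟨homogeneous place v.1 z,
      grCycles_le_Z hg v.2 (homogeneous_mem_grCycles_of_mem_Z hg v.2 hz)⟩
  have hsum : (∑ v ∈ W, c v).1 = ∑ v ∈ W, homogeneous place v.1 z :=
    AddSubmonoidClass.coe_finsetSum _ _
  have hm : ∑ v ∈ W, toFirstPage hg i j v.2
      (ofFirstPage hg i j v.2 (Submodule.Quotient.mk ⟨z, hz⟩)) =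
      Submodule.Quotient.mk (∑ v ∈ W, c v) :=
    (map_sum (Submodule.mkQ _) c W).symm
  refine ⟨W, hm.trans ((FilteredComplex.mk_eq_mk_iff (∑ v ∈ W, c v).2 hz).2
    (FilteredComplex.mem_N.2 ⟨(∑ v ∈ W, c v).1 - z, 0, ⟨?_, ?_⟩, by simp, by simp⟩))⟩
  · have hx0 : ∀ x, gDeg place x ∈ Finset.univ.image (gDeg place) := fun x =>
      Finset.mem_image_of_mem _ (Finset.mem_univ x)
    have hFm := sub_mem (∑ v ∈ W, c v).2.1 hz.1
    intro x hx
    obtain ⟨h1, h2, h3⟩ := hFm x hx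
    refine ⟨h1, h2, Int.le_sub_one_of_lt (h3.lt_of_ne fun h => hx ?_)⟩
    rw [hsum, Pi.sub_apply, Finset.sum_apply, Finset.sum_eq_single_of_mem ⟨gDeg place x, h⟩
      (Finset.mem_subtype.2 (hx0 x)), homogeneous_apply_of_eq place z rfl, sub_self]
    exact fun w _ hw => homogeneous_apply_of_ne place z fun h' => hw (Subtype.ext h'.symm)
  · rw [map_sub]
    exact sub_mem (∑ v ∈ W, c v).2.2 hz.2

end FirstPage
end LinkDiagram

end

theorem theorem6 {𝕜 : Type*} [Field 𝕜] {X X' : PuncturedDisk}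
    (h : X'.punctures ⊆ X.punctures) {k : ℕ} (L : Link X k) (D : L.Diagram) :
    ∃ E : FilteredSpectralSequence 𝕜,
      (∀ p i j : ℤ, Nonempty ((E.page 1 le_rfl).X (p, i, j) ≅ ModuleCat.of 𝕜 (D.flatMKh 𝕜 i j p))) ∧
      E.ConvergesTo (fun i j => (D.fill h).totalMKh 𝕜 i j) (D.filtration 𝕜 h) := by
  refine ⟨(LinkDiagram.filteredComplex D.place (D.fill h).place).spectralSequence,
    fun p i j => ?_, LinkDiagram.filteredComplex_convergesTo⟩
  -- The degree for `X'` consists of some of the components of the degree for `X`.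
  obtain ⟨e⟩ := LinkDiagram.nonempty_firstPage_equiv (𝕜 := 𝕜) (place := D.place)
    (place' := (D.fill h).place) (fun x y hxy => funext fun q => congrFun hxy ⟨q.1, h q.2⟩) p i j
  exact ⟨e.toModuleIso⟩
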